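/- Let $N\ge 1$, let $\mathbb D$ be the open unit ball of $\mathbb R^{N+1}$ with the Poincaré metric $d$ of curvature $-1$, $\mathbb S=\partial\mathbb D$, $\overline{\mathbb D}=\mathbb D\cup\mathbb S$, and let $\mathrm{Con}(N)$ be the group of orientation-preserving isometries of $(\mathbb D,d)$, extended continuously to $\overline{\mathbb D}$. Let $G$ be a Kleinian group, that is, a discrete subgroup of $\mathrm{Con}(N)$. For $g\in G$ and $z\in\overline{\mathbb D}$ let $$j(g,z)=\frac{1-|a|^2}{1-2\langle z,a\rangle+|z|^2|a|^2},\qquad a=g^{-1}(0),$$ be the conformal derivative of $g$ at $z$, let $P(z,s)=\sum_{g\in G}j(g,z)^s$ for $z\in\mathbb D$ (whether this series converges does not depend on $z\in\mathbb D$), and let $\delta(G)=\inf\{s\ge 0: P(0,s)<\infty\}$. Let $L(G)=\overline{G(0)}\setminus G(0)$ be the limit set. The big horospherical limit set $L_H(G)$ consists of all $\zeta\in L(G)$ for which there is a $c>0$ such that the orbit $G(0)$ accumulates at $\zeta$ within the horoball $\{z\in\mathbb D:(1-|z|^2)/|\zeta-z|^2>c\}$. A parabolic fixed point of $G$ is a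 point of $\mathbb S$ fixed by an element of $G$ which has precisely one fixed point in $\mathbb S$. For a point $z_0\in\mathbb D$ not fixed by any non-trivial element of $G$, let $F=\{z\in\mathbb D: d(z,z_0)<d(z,g(z_0))\text{ for all }g\in G\setminus\{\mathrm{id}\}\}$ be the Dirichlet fundamental domain of $G$ with centre $z_0$. An ending sequence in $F$ tending to $\zeta\in\mathbb S$ is a sequence of points $z_n\in F$ which converges to $\zeta$ in the Euclidean metric and stays within a bounded hyperbolic distance of some geodesic ray towards $\zeta$ contained in $F$. If $P(z,s)<\infty$ for $z\in\mathbb D$, then an $s$-conformal ending measure for $G$ is a Borel probability measure on $\overline{\mathbb D}$ which is a weak limit, along a subsequence, of the measures $$\mu_n=\frac1{P(z_n,s)}\sum_{g\in G}j(g,z_n)^s\,\mathbf 1_{g(z_n)}$$ for some ending sequence $(z_n)$ in some Dirichlet fundamental domain of $G$, where $\mathbf 1_x$ is the unit point mass at $x$. (If $P(z,s)=\infty$, there are no $s$-conformal ending measures for $G$.) Theorem. Let $G$ be a Kleinian group and let $s\ge\delta(G)$ be real. The following are equivalent. (i) Every $s$-conformal ending measure $\mu$ for $G$ supported on $L(G)$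 is essentially supported on $L_H(G)$, that is, $\mu(\overline{\mathbb D}\setminus L_H(G))=0$. (ii) Every $s$-conformal ending measure for $G$ supported on $L(G)$ has atoms only at parabolic fixed points of $G$. -/

import Mathlib

open MeasureTheory Filter Topology
open scoped ENNReal

namespace Kleinian

/-- The closed Euclidean unit ball in `ℝ^(N+1)`: hyperbolic `(N+1)`-space (the open ball)
together with its boundary sphere. -/
abbrev Ball (N : ℕ) : Type :=
  Metric.closedBall (0 : EuclideanSpace ℝ (Fin (N + 1))) 1

variable {N : ℕ}

/-- The centre of the ball. -/
def origin (N : ℕ) : Ball N := ⟨0, Metric.mem_closedBall_self zero_le_one⟩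

/-- Hyperbolic space: the open unit ball. -/
def openBall (N : ℕ) : Set (Ball N) := {x | ‖(x : EuclideanSpace ℝ (Fin (N + 1)))‖ < 1}

/-- The boundary sphere at infinity. -/
def sphere (N : ℕ) : Set (Ball N) := {x | ‖(x : EuclideanSpace ℝ (Fin (N + 1)))‖ = 1}

/-- The hyperbolic distance (curvature `-1`) of the Poincaré ball model. Only used for points of
the open ball. -/
noncomputable def hypDist (x y : Ball N) : ℝ :=
  Real.arcosh (1 + 2 * ‖(x : EuclideanSpace ℝ (Fin (N + 1))) - y‖ ^ 2 /
    ((1 - ‖(x : EuclideanSpace ℝ (Fin (N + 1)))‖ ^ 2) *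
      (1 - ‖(y : EuclideanSpace ℝ (Fin (N + 1)))‖ ^ 2)))

/-- Elements of the conformal group: orientation-preserving hyperbolic isometries, together with
their (unique) continuous extension to the closed ball. Hyperbolic isometries are smooth on the
open ball, so that orientation can be read off from the sign of the Jacobian determinant. -/
structure IsConformal (g : Ball N ≃ₜ Ball N) : Prop where
  map_openBall : ∀ x, g x ∈ openBall N ↔ x ∈ openBall N
  isometry : ∀ x ∈ openBall N, ∀ y ∈ openBall N, hypDist (g x) (g y) = hypDist x y
  orientation : ∀ x ∈ openBall N,
    0 < (fderiv ℝ (Function.extend Subtype.val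
      (fun y : Ball N => (g y : EuclideanSpace ℝ (Fin (N + 1)))) 0)
        (x : EuclideanSpace ℝ (Fin (N + 1)))).det

/-- A Kleinian group: a subgroup of the conformal group which is discrete in the topology of
uniform convergence on the closed ball (the compact-open topology). -/
structure IsKleinian (G : Subgroup (Ball N ≃ₜ Ball N)) : Prop where
  conformal : ∀ g ∈ G, IsConformal g
  discrete : IsDiscrete ((fun g : Ball N ≃ₜ Ball N => (⟨g, g.continuous⟩ : C(Ball N, Ball N))) ''
    (G : Set (Ball N ≃ₜ Ball N)))

/-- The orbit `G(z)`. -/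
def orbit (G : Subgroup (Ball N ≃ₜ Ball N)) (z : Ball N) : Set (Ball N) :=
  {x | ∃ g ∈ G, g z = x}

/-- The limit set `L(G)`: the closure of the orbit of the origin minus this orbit. -/
def limitSet (G : Subgroup (Ball N ≃ₜ Ball N)) : Set (Ball N) :=
  closure (orbit G (origin N)) \ orbit G (origin N)

/-- The Poisson kernel `k(z, ζ) = (1 - |z|²) / |ζ - z|²`. -/
noncomputable def ballPoissonKernel (z ζ : Ball N) : ℝ :=
  (1 - ‖(z : EuclideanSpace ℝ (Fin (N + 1)))‖ ^ 2) /
    ‖(ζ : EuclideanSpace ℝ (Fin (N + 1))) - z‖ ^ 2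

/-- The open horoball `H_ζ(c)`. -/
def horoball (ζ : Ball N) (c : ℝ) : Set (Ball N) :=
  {z | z ∈ openBall N ∧ c < ballPoissonKernel z ζ}

/-- The big horospherical limit set `L_H(G)`: limit points at which the orbit of the origin
accumulates within some horoball. -/
def bigHorosphericalLimitSet (G : Subgroup (Ball N ≃ₜ Ball N)) : Set (Ball N) :=
  {ζ | ζ ∈ limitSet G ∧ ∃ c : ℝ, 0 < c ∧ AccPt ζ (𝓟 (orbit G (origin N) ∩ horoball ζ c))}

/-- A parabolic element: exactly one fixed point on the boundary sphere. -/
def IsParabolic (g : Ball N ≃ₜ Ball N) : Prop := ∃! ξ : Ball N, ξ ∈ sphere N ∧ g ξ = ξ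

/-- `ζ` is a boundary point which is fixed by a parabolic element of `G`. -/
def IsParabolicFixedPoint (G : Subgroup (Ball N ≃ₜ Ball N)) (ζ : Ball N) : Prop :=
  ζ ∈ sphere N ∧ ∃ g ∈ G, IsParabolic g ∧ g ζ = ζ

/-- The conformal derivative, with `a = g⁻¹(0)`:
`j(g, z) = (1 - |a|²) / (|z* - a|² |z|²)`, where `z* = z / |z|²`. The denominator is written out as
`|z* - a|² |z|² = 1 - 2⟨z, a⟩ + |z|² |a|²`, which covers `z = 0` too and is positive for all `z` in
the closed ball. -/
noncomputable def conformalDeriv (g : Ball N ≃ₜ Ball N) (z : Ball N) : ℝ :=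
  (1 - ‖(g.symm (origin N) : EuclideanSpace ℝ (Fin (N + 1)))‖ ^ 2) /
    (1 - 2 * inner ℝ (z : EuclideanSpace ℝ (Fin (N + 1))) (g.symm (origin N))
      + ‖(z : EuclideanSpace ℝ (Fin (N + 1)))‖ ^ 2 *
        ‖(g.symm (origin N) : EuclideanSpace ℝ (Fin (N + 1)))‖ ^ 2)

/-- The Poincaré series `P(z, s) = ∑_{g ∈ G} j(g, z)^s`, with value `∞` if it diverges. -/
noncomputable def poincareSeries (G : Subgroup (Ball N ≃ₜ Ball N)) (z : Ball N) (s : ℝ) : ℝ≥0∞ :=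
  ∑' g : G, ENNReal.ofReal (conformalDeriv (g : Ball N ≃ₜ Ball N) z ^ s)

/-- The exponent of convergence `δ(G)`, an infimum of nonnegative reals, as an extended real. -/
noncomputable def criticalExponent (G : Subgroup (Ball N ≃ₜ Ball N)) : EReal :=
  sInf ((fun t : ℝ => (t : EReal)) '' {t : ℝ | 0 ≤ t ∧ poincareSeries G (origin N) t < ∞})

/-- `z₀` can serve as the centre of a Dirichlet domain: a point of hyperbolic space which is not
fixed by any nontrivial element of `G`. -/
def IsDirichletCentre (G : Subgroup (Ball N ≃ₜ Ball N)) (z₀ : Ball N) : Prop :=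
  z₀ ∈ openBall N ∧ ∀ g ∈ G, g z₀ = z₀ → g = 1

/-- The Dirichlet fundamental domain of `G` with centre `z₀`. -/
def dirichletDomain (G : Subgroup (Ball N ≃ₜ Ball N)) (z₀ : Ball N) : Set (Ball N) :=
  {z | z ∈ openBall N ∧ ∀ g ∈ G, g ≠ 1 → hypDist z z₀ < hypDist z (g z₀)}

/-- `ρ`, restricted to `[0, ∞)`, is a hyperbolic geodesic ray (parametrised by arc length)
towards the boundary point `ζ`. -/
structure IsGeodesicRay (ρ : ℝ → Ball N) (ζ : Ball N) : Prop where
  mem_sphere : ζ ∈ sphere N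
  mem_openBall : ∀ t, 0 ≤ t → ρ t ∈ openBall N
  isometry : ∀ t u, 0 ≤ t → 0 ≤ u → hypDist (ρ t) (ρ u) = |t - u|
  tendsto : Tendsto ρ atTop (𝓝 ζ)

/-- `(zₙ)` is an ending sequence tending to `ζ` in the Dirichlet domain with centre `z₀`: it stays
within bounded distance from a geodesic ray towards `ζ` contained in the domain. In particular `ζ`
lies in the closure of the domain. -/
structure IsEndingSequence (G : Subgroup (Ball N ≃ₜ Ball N)) (z₀ ζ : Ball N) (z : ℕ → Ball N) :
    Prop where
  mem : ∀ n, z n ∈ dirichletDomain G z₀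
  near_ray : ∃ ρ : ℝ → Ball N, IsGeodesicRay ρ ζ ∧ (∀ t, 0 ≤ t → ρ t ∈ dirichletDomain G z₀) ∧
    ∃ R : ℝ, ∀ n, ∃ t, 0 ≤ t ∧ hypDist (z n) (ρ t) ≤ R
  tendsto : Tendsto z atTop (𝓝 ζ)

/-- The atomic measure `P(z, s)⁻¹ ∑_{g ∈ G} j(g, z)^s δ_{g(z)}`. -/
noncomputable def orbitMeasure (G : Subgroup (Ball N ≃ₜ Ball N)) (s : ℝ) (z : Ball N) :
    Measure (Ball N) :=
  (poincareSeries G z s)⁻¹ • Measure.sum fun g : G =>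
    ENNReal.ofReal (conformalDeriv (g : Ball N ≃ₜ Ball N) z ^ s) •
      Measure.dirac ((g : Ball N ≃ₜ Ball N) z)

/-- `μ` is an `s`-conformal ending measure for `G`: the Poincaré series converges at `s`, and `μ`
is the weak limit, along a subsequence, of the measures `orbitMeasure G s (zₙ)` (which are
probability measures) for an ending sequence `(zₙ)` in some Dirichlet domain of `G`. -/
def IsEndingMeasure (G : Subgroup (Ball N ≃ₜ Ball N)) (s : ℝ) (μ : ProbabilityMeasure (Ball N)) :
    Prop :=
  (∀ z ∈ openBall N, poincareSeries G z s < ∞) ∧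
  ∃ (z₀ ζ : Ball N) (z : ℕ → Ball N), IsDirichletCentre G z₀ ∧ IsEndingSequence G z₀ ζ z ∧
    ∃ φ : ℕ → ℕ, StrictMono φ ∧ ∃ ν : ℕ → ProbabilityMeasure (Ball N),
      (∀ n, (ν n : Measure (Ball N)) = orbitMeasure G s (z (φ n))) ∧ Tendsto ν atTop (𝓝 μ)

end Kleinian

/-!
The exponent `s` is positive as soon as there is an ending measure supported on the limit set, and
then convergence of the Poincaré series replaces discreteness: only finitely many elements of `G`
move the origin to a given smaller ball. Orientation plays no role. From the preservation of the
hyperbolic distance one gets, by density of the open ball, the chain rule for `conformalDeriv` and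
`|g x - g y|² = j(g, x) j(g, y) |x - y|²` on the closed ball (`IsConformal.normSq_map_sub`). The orbit
measures, and hence all ending measures, are `s`-conformal for `G`
(`IsEndingMeasure.isConformalMeasure`).

Let `ζ` be an atom of an ending measure `μ`. Elements of `G` fixing `ζ` have derivative one there,
hence act as Euclidean isometries in the stereographic projection from `ζ`. A discrete group of
Euclidean isometries all of whose elements have fixed points is finite
(`IsAffineAction.finite_of_forall_exists_fixed`, an argument in the spirit of Bieberbach), so `ζ` is
a parabolic fixed point exactly if its stabilizer is infinite
(`isParabolicFixedPoint_iff_infinite`). If `ζ` is in the big horospherical limit set, then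
`j(g, ζ)` is bounded below for infinitely many `g`; as `μ {g ζ} = j(g, ζ)^s μ {ζ}` and `μ` is finite,
infinitely many of the points `g ζ` coincide, and the stabilizer is infinite. This proves one
implication.

Conversely, outside the big horospherical limit set the action of `G` is dissipative: the points
at which no derivative exceeds one form a fundamental set up to finite multiplicities, and summing
the masses of its translates gives `∑ j(g, ζ)^s < ∞` for almost every such `ζ`
(`IsConformalMeasure.ae_poincareSeries_lt_top`). If the set of such `ζ` has positive measure, take
one of them and move it by an element of `G` such that the Poisson kernel at `ζ`, over the orbit of
the centre `z₀` of a Dirichlet domain, is maximal at `z₀`. Then the geodesic ray from `z₀` to `ζ` lies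
in the domain, and by dominated convergence the orbit measures along this ray converge to the
orbit measure of `ζ` (`exists_isEndingMeasure_eq_orbitMeasure`). This ending measure has an atom at
`ζ`, which has finite stabilizer and therefore is not a parabolic fixed point
(`exists_isEndingMeasure_atom`).
-/

namespace Kleinian

variable {N : ℕ}

/-! ### Conformal distortion on the closed ball -/

theorem mem_openBall_iff {x : Ball N} :
    x ∈ openBall N ↔ ‖(x : EuclideanSpace ℝ (Fin (N + 1)))‖ < 1 := Iff.rfl

theorem mem_sphere_iff {x : Ball N} :
    x ∈ sphere N ↔ ‖(x : EuclideanSpace ℝ (Fin (N + 1)))‖ = 1 := Iff.rfl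

theorem norm_le_one (x : Ball N) : ‖(x : EuclideanSpace ℝ (Fin (N + 1)))‖ ≤ 1 :=
  mem_closedBall_zero_iff.1 x.2

theorem one_sub_normSq_pos {x : Ball N} (hx : x ∈ openBall N) :
    0 < 1 - ‖(x : EuclideanSpace ℝ (Fin (N + 1)))‖ ^ 2 := by
  have := mem_openBall_iff.1 hx
  nlinarith [norm_nonneg (x : EuclideanSpace ℝ (Fin (N + 1)))]

theorem origin_mem_openBall : origin N ∈ openBall N := by
  simp [openBall, origin]

theorem dense_openBall : Dense (openBall N) := by
  intro x
  have hlim : Tendsto (fun n : ℕ => (n / (n + 1) : ℝ) • (x : EuclideanSpace ℝ (Fin (N + 1))))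
      atTop (𝓝 ((1 : ℝ) • (x : EuclideanSpace ℝ (Fin (N + 1))))) :=
    (tendsto_natCast_div_add_atTop (1 : ℝ)).smul_const _
  rw [one_smul] at hlim
  have hlt : ∀ n : ℕ, ‖(n / (n + 1) : ℝ) • (x : EuclideanSpace ℝ (Fin (N + 1)))‖ < 1 := by
    intro n
    have h1 : (n / (n + 1) : ℝ) < 1 := by rw [div_lt_one (by positivity)]; linarith
    have h0 : (0 : ℝ) ≤ n / (n + 1) := by positivity
    rw [norm_smul, Real.norm_of_nonneg h0]
    nlinarith [norm_le_one x, norm_nonneg (x : EuclideanSpace ℝ (Fin (N + 1)))]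
  refine mem_closure_of_tendsto
    (f := fun n : ℕ => (⟨_, mem_closedBall_zero_iff.2 (hlt n).le⟩ : Ball N)) (b := atTop) ?_
    (Eventually.of_forall fun n => hlt n)
  exact tendsto_subtype_rng.2 hlim

theorem cosh_hypDist {x y : Ball N} (hx : x ∈ openBall N) (hy : y ∈ openBall N) :
    Real.cosh (hypDist x y) =
      1 + 2 * ‖(x : EuclideanSpace ℝ (Fin (N + 1))) - y‖ ^ 2 /
        ((1 - ‖(x : EuclideanSpace ℝ (Fin (N + 1)))‖ ^ 2) *
          (1 - ‖(y : EuclideanSpace ℝ (Fin (N + 1)))‖ ^ 2)) := by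
  have := one_sub_normSq_pos hx
  have := one_sub_normSq_pos hy
  refine Real.cosh_arcosh ?_
  rw [le_add_iff_nonneg_right]
  positivity

theorem hypDist_nonneg {x y : Ball N} (hx : x ∈ openBall N) (hy : y ∈ openBall N) :
    0 ≤ hypDist x y := by
  refine Real.arcosh_nonneg ?_
  have := one_sub_normSq_pos hx
  have := one_sub_normSq_pos hy
  rw [le_add_iff_nonneg_right]
  positivity

theorem hypDist_self (x : Ball N) : hypDist x x = 0 := by simp [hypDist]

/-- The denominator of `conformalDeriv` in terms of the Euclidean distance. -/
theorem denom_eq {E : Type*} [NormedAddCommGroup E] [InnerProductSpace ℝ E] (z a : E) :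
    1 - 2 * inner ℝ z a + ‖z‖ ^ 2 * ‖a‖ ^ 2 =
      ‖z - a‖ ^ 2 + (1 - ‖z‖ ^ 2) * (1 - ‖a‖ ^ 2) := by
  rw [norm_sub_sq_real]; ring

theorem sq_one_sub_norm_le_denom {E : Type*} [NormedAddCommGroup E] [InnerProductSpace ℝ E]
    {z a : E} (hz : ‖z‖ ≤ 1) (ha : ‖a‖ ≤ 1) :
    (1 - ‖z‖) ^ 2 ≤ 1 - 2 * inner ℝ z a + ‖z‖ ^ 2 * ‖a‖ ^ 2 := by
  have h1 : ‖z‖ * ‖a‖ ≤ ‖z‖ := mul_le_of_le_one_right (norm_nonneg _) ha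
  have h2 := real_inner_le_norm z a
  have h3 : (1 - ‖z‖) ^ 2 ≤ (1 - ‖z‖ * ‖a‖) ^ 2 :=
    pow_le_pow_left₀ (by linarith) (by linarith) 2
  nlinarith

theorem denom_pos {E : Type*} [NormedAddCommGroup E] [InnerProductSpace ℝ E]
    {z a : E} (hz : ‖z‖ ≤ 1) (ha : ‖a‖ < 1) :
    0 < 1 - 2 * inner ℝ z a + ‖z‖ ^ 2 * ‖a‖ ^ 2 := by
  have h := sq_one_sub_norm_le_denom ha.le hz
  rw [real_inner_comm] at h
  nlinarith

namespace IsConformal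

variable {g h : Ball N ≃ₜ Ball N}

theorem symm_origin_mem (hg : IsConformal g) : g.symm (origin N) ∈ openBall N := by
  rw [← hg.map_openBall, g.apply_symm_apply]
  exact origin_mem_openBall

theorem conformalDeriv_pos (hg : IsConformal g) (z : Ball N) : 0 < conformalDeriv g z :=
  div_pos (one_sub_normSq_pos hg.symm_origin_mem) (denom_pos (norm_le_one z) hg.symm_origin_mem)

theorem continuous_conformalDeriv (hg : IsConformal g) : Continuous (conformalDeriv g) := by
  unfold conformalDeriv
  refine Continuous.div (by fun_prop) (by fun_prop) fun z => ?_
  exact (denom_pos (norm_le_one z) hg.symm_origin_mem).ne'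

theorem one_sub_normSq_map (hg : IsConformal g) {z : Ball N} (hz : z ∈ openBall N) :
    1 - ‖(g z : EuclideanSpace ℝ (Fin (N + 1)))‖ ^ 2 =
      conformalDeriv g z * (1 - ‖(z : EuclideanSpace ℝ (Fin (N + 1)))‖ ^ 2) := by
  have h := hg.isometry z hz _ hg.symm_origin_mem
  rw [g.apply_symm_apply] at h
  have h' := congrArg Real.cosh h
  have hgz := (hg.map_openBall z).2 hz
  rw [cosh_hypDist hgz origin_mem_openBall, cosh_hypDist hz hg.symm_origin_mem] at h'
  have ha := one_sub_normSq_pos hg.symm_origin_mem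
  have hz' := one_sub_normSq_pos hz
  have hgz' := one_sub_normSq_pos hgz
  have hd := denom_pos (norm_le_one z) (mem_openBall_iff.1 hg.symm_origin_mem)
  unfold conformalDeriv
  rw [denom_eq] at *
  simp only [origin, sub_zero, norm_zero] at h' ha hd ⊢
  generalize ‖(z : EuclideanSpace ℝ (Fin (N + 1))) - (g.symm ⟨0, _⟩ : Ball N)‖ ^ 2 = D at *
  generalize ‖((g.symm ⟨0, _⟩ : Ball N) : EuclideanSpace ℝ (Fin (N + 1)))‖ ^ 2 = a at *
  generalize ‖(g z : EuclideanSpace ℝ (Fin (N + 1)))‖ ^ 2 = w at *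
  generalize ‖(z : EuclideanSpace ℝ (Fin (N + 1)))‖ ^ 2 = y at *
  have hd0 := hd.ne'
  field_simp at h' ⊢
  linarith

theorem normSq_map_sub_of_mem (hg : IsConformal g) {x y : Ball N} (hx : x ∈ openBall N)
    (hy : y ∈ openBall N) :
    ‖(g x : EuclideanSpace ℝ (Fin (N + 1))) - g y‖ ^ 2 =
      conformalDeriv g x * conformalDeriv g y *
        ‖(x : EuclideanSpace ℝ (Fin (N + 1))) - y‖ ^ 2 := by
  have h' := congrArg Real.cosh (hg.isometry x hx y hy)
  rw [cosh_hypDist ((hg.map_openBall x).2 hx) ((hg.map_openBall y).2 hy), cosh_hypDist hx hy,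
    hg.one_sub_normSq_map hx, hg.one_sub_normSq_map hy] at h'
  have := hg.conformalDeriv_pos x
  have := hg.conformalDeriv_pos y
  have := one_sub_normSq_pos hx
  have := one_sub_normSq_pos hy
  field_simp at h'
  linarith

/-- `g` distorts Euclidean distances by the geometric mean of its conformal derivatives at the two
points. -/
theorem normSq_map_sub (hg : IsConformal g) (x y : Ball N) :
    ‖(g x : EuclideanSpace ℝ (Fin (N + 1))) - g y‖ ^ 2 =
      conformalDeriv g x * conformalDeriv g y *
        ‖(x : EuclideanSpace ℝ (Fin (N + 1))) - y‖ ^ 2 := by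
  have hj := hg.continuous_conformalDeriv
  have hgc := g.continuous
  have key : (fun p : Ball N × Ball N => ‖(g p.1 : EuclideanSpace ℝ (Fin (N + 1))) - g p.2‖ ^ 2) =
      fun p => conformalDeriv g p.1 * conformalDeriv g p.2 *
        ‖(p.1 : EuclideanSpace ℝ (Fin (N + 1))) - p.2‖ ^ 2 := by
    refine Continuous.ext_on (dense_openBall.prod dense_openBall) (by fun_prop) (by fun_prop) ?_
    rintro ⟨x, y⟩ ⟨hx, hy⟩
    exact hg.normSq_map_sub_of_mem hx hy
  exact congrFun key (x, y)

theorem map_sphere (hg : IsConformal g) (x : Ball N) : g x ∈ sphere N ↔ x ∈ sphere N := by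
  have key : ∀ y : Ball N, y ∈ sphere N ↔ ¬ y ∈ openBall N := fun y => by
    rw [mem_sphere_iff, mem_openBall_iff, not_lt]
    exact ⟨fun h => h.ge, fun h => le_antisymm (norm_le_one y) h⟩
  rw [key, key, hg.map_openBall]

/-- The chain rule. -/
theorem conformalDeriv_mul (hg : IsConformal g) (hh : IsConformal h) (hgh : IsConformal (g * h))
    (z : Ball N) : conformalDeriv (g * h) z = conformalDeriv g (h z) * conformalDeriv h z := by
  have key : conformalDeriv (g * h) = fun z => conformalDeriv g (h z) * conformalDeriv h z := by
    refine Continuous.ext_on dense_openBall hgh.continuous_conformalDeriv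
      ((hg.continuous_conformalDeriv.comp h.continuous).mul hh.continuous_conformalDeriv) ?_
    intro z hz
    have h1 := hgh.one_sub_normSq_map hz
    have h2 := hg.one_sub_normSq_map ((hh.map_openBall z).2 hz)
    rw [hh.one_sub_normSq_map hz, ← mul_assoc] at h2
    exact mul_right_cancel₀ (one_sub_normSq_pos hz).ne' (h1.symm.trans h2)
  exact congrFun key z

theorem ballPoissonKernel_map (hg : IsConformal g) {z : Ball N} (hz : z ∈ openBall N)
    (ζ : Ball N) :
    ballPoissonKernel (g z) (g ζ) = ballPoissonKernel z ζ / conformalDeriv g ζ := by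
  unfold ballPoissonKernel
  rw [hg.normSq_map_sub, hg.one_sub_normSq_map hz]
  have h1 := (hg.conformalDeriv_pos z).ne'
  rw [mul_comm (conformalDeriv g ζ), mul_assoc, mul_div_mul_left _ _ h1, div_div,
    mul_comm (conformalDeriv g ζ)]

end IsConformal

theorem conformalDeriv_one (z : Ball N) : conformalDeriv (1 : Ball N ≃ₜ Ball N) z = 1 := by
  have : (1 : Ball N ≃ₜ Ball N).symm (origin N) = origin N := rfl
  rw [conformalDeriv, this]
  simp [origin]

theorem conformalDeriv_origin (g : Ball N ≃ₜ Ball N) :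
    conformalDeriv g (origin N) =
      1 - ‖(g.symm (origin N) : EuclideanSpace ℝ (Fin (N + 1)))‖ ^ 2 := by
  simp [conformalDeriv, origin]

/-- On the sphere the conformal derivative is the Poisson kernel of the point `g⁻¹(0)`. -/
theorem conformalDeriv_eq_ballPoissonKernel (g : Ball N ≃ₜ Ball N) {ζ : Ball N}
    (hζ : ζ ∈ sphere N) :
    conformalDeriv g ζ = ballPoissonKernel (g.symm (origin N)) ζ := by
  unfold conformalDeriv ballPoissonKernel
  rw [denom_eq, mem_sphere_iff.1 hζ]
  simp

theorem ballPoissonKernel_pos {z ζ : Ball N} (hz : z ∈ openBall N) (hζ : ζ ∈ sphere N) :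
    0 < ballPoissonKernel z ζ := by
  refine div_pos (one_sub_normSq_pos hz) (pow_pos (norm_pos_iff.2 fun h => ?_) 2)
  have := mem_openBall_iff.1 hz
  rw [← sub_eq_zero.1 h, mem_sphere_iff.1 hζ] at this
  exact lt_irrefl _ this

/-- Harnack's bound for the Poisson kernel. -/
theorem ballPoissonKernel_le {z ζ : Ball N} (hz : z ∈ openBall N) (hζ : ζ ∈ sphere N) :
    ballPoissonKernel z ζ ≤ (1 - ‖(z : EuclideanSpace ℝ (Fin (N + 1)))‖ ^ 2) /
      (1 - ‖(z : EuclideanSpace ℝ (Fin (N + 1)))‖) ^ 2 := by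
  have h1 := mem_openBall_iff.1 hz
  have h2 := norm_sub_norm_le (ζ : EuclideanSpace ℝ (Fin (N + 1))) z
  rw [mem_sphere_iff.1 hζ] at h2
  refine div_le_div_of_nonneg_left (one_sub_normSq_pos hz).le (pow_pos (by linarith) 2)
    (pow_le_pow_left₀ (by linarith) h2 2)

/-! ### Discrete groups of Euclidean isometries without free elements -/

section Euclidean

variable {V : Type*} [NormedAddCommGroup V] [NormedSpace ℝ V] {Γ : Type*} [Group Γ]

/-- An affine action of the group `Γ` on a normed space by the maps `x ↦ A γ x + a γ`. The bound on
the norms of the linear parts, applied to inverses, makes these maps isometries. -/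
structure IsAffineAction (A : Γ →* (V →L[ℝ] V)) (a : Γ → V) : Prop where
  norm_le : ∀ γ, ‖A γ‖ ≤ 1
  cocycle : ∀ γ η, a (γ * η) = a γ + A γ (a η)

/-- A linear operator all of whose powers are close to the identity is the identity: the displacement of a
vector under `T²` is at least `3/2` times its displacement under `T`. -/
theorem eq_one_of_forall_norm_pow_sub_one_le {T : V →L[ℝ] V}
    (hT : ∀ k : ℕ, ‖T ^ k - 1‖ ≤ 1 / 2) : T = 1 := by
  have key : ∀ (k : ℕ) (v : V), (3 / 2 : ℝ) ^ k * ‖(T - 1) v‖ ≤ ‖(T ^ 2 ^ k - 1 : V →L[ℝ] V) v‖ := by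
    intro k v
    induction k with
    | zero => simp
    | succ k ih =>
      set S := T ^ 2 ^ k with hS
      have h1 : (T ^ 2 ^ (k + 1) - 1 : V →L[ℝ] V) v =
          (2 : ℝ) • (S - 1) v + (S - 1) ((S - 1) v) := by
        have : (T ^ 2 ^ (k + 1) - 1 : V →L[ℝ] V) = (2 : ℝ) • (S - 1) + (S - 1) * (S - 1) := by
          rw [pow_succ, pow_mul, ← hS, two_smul]; noncomm_ring
        rw [this]; rfl
      have h2 : ‖(S - 1) ((S - 1) v)‖ ≤ 1 / 2 * ‖(S - 1) v‖ :=
        (S - 1).le_of_opNorm_le (hT _) _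
      have h3 : ‖(2 : ℝ) • (S - 1) v‖ = 2 * ‖(S - 1) v‖ := by
        rw [norm_smul]; norm_num
      have h4 := norm_sub_le_norm_add ((2 : ℝ) • (S - 1) v) ((S - 1) ((S - 1) v))
      rw [h1, pow_succ]
      linarith
  refine ContinuousLinearMap.ext fun v => ?_
  by_contra hv
  have hpos : 0 < ‖(T - 1) v‖ := norm_pos_iff.2 fun h => hv (sub_eq_zero.1 h)
  obtain ⟨k, hk⟩ := pow_unbounded_of_one_lt (1 / 2 * ‖v‖ / ‖(T - 1) v‖)
    (by norm_num : (1 : ℝ) < 3 / 2)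
  rw [div_lt_iff₀ hpos] at hk
  exact absurd ((key k v).trans ((T ^ 2 ^ k - 1 : V →L[ℝ] V).le_of_opNorm_le (hT _) v)) (not_le.2 hk)

namespace IsAffineAction

variable {A : Γ →* (V →L[ℝ] V)} {a : Γ → V}

theorem map_mul_inv (γ : Γ) : A γ * A γ⁻¹ = 1 := by rw [← map_mul, mul_inv_cancel, map_one]

theorem linear_conj (γ η : Γ) : A γ * (A η - 1) * A γ⁻¹ = A (γ * η * γ⁻¹) - 1 := by
  rw [mul_sub, sub_mul, mul_one, map_mul_inv, map_mul, map_mul]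

theorem norm_mul_le (hA : IsAffineAction A a) (γ : Γ) (T : V →L[ℝ] V) : ‖A γ * T‖ ≤ ‖T‖ :=
  (_root_.norm_mul_le _ _).trans (mul_le_of_le_one_left (norm_nonneg _) (hA.norm_le γ))

theorem norm_mul_right_le (hA : IsAffineAction A a) (γ : Γ) (T : V →L[ℝ] V) : ‖T * A γ‖ ≤ ‖T‖ :=
  (_root_.norm_mul_le _ _).trans (mul_le_of_le_one_right (norm_nonneg _) (hA.norm_le γ))

theorem map_one (hA : IsAffineAction A a) : a 1 = 0 := by
  simpa using hA.cocycle 1 1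

theorem map_inv (hA : IsAffineAction A a) (γ : Γ) : a γ⁻¹ = - A γ⁻¹ (a γ) := by
  have := hA.cocycle γ⁻¹ γ
  rw [inv_mul_cancel, hA.map_one] at this
  exact eq_neg_of_add_eq_zero_left this.symm

open scoped commutatorElement

theorem norm_linear_commutator_le (hA : IsAffineAction A a) (γ η : Γ) :
    ‖A ⁅γ, η⁆ - 1‖ ≤ 2 * ‖A γ - 1‖ * ‖A η - 1‖ := by
  have h : A ⁅γ, η⁆ - 1 =
      ((A γ - 1) * (A η - 1) - (A η - 1) * (A γ - 1)) * A (γ⁻¹ * η⁻¹) := by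
    have h1 : A η * A γ * A (γ⁻¹ * η⁻¹) = 1 := by
      rw [← map_mul, ← map_mul]; simp
    have h2 : A γ * A η * A (γ⁻¹ * η⁻¹) = A ⁅γ, η⁆ := by
      rw [← map_mul, ← map_mul, commutatorElement_def]; congr 1; group
    have h3 : (A γ - 1) * (A η - 1) - (A η - 1) * (A γ - 1) = A γ * A η - A η * A γ := by
      noncomm_ring
    rw [h3, sub_mul, h1, h2]
  rw [h]
  refine (hA.norm_mul_right_le _ _).trans ((norm_sub_le _ _).trans ?_)
  have h1 := _root_.norm_mul_le (A γ - 1) (A η - 1)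
  have h2 := _root_.norm_mul_le (A η - 1) (A γ - 1)
  linarith

theorem norm_translation_commutator_le (hA : IsAffineAction A a) (γ η : Γ) :
    ‖a ⁅γ, η⁆‖ ≤ ‖A η - 1‖ * ‖a γ‖ + (‖A γ - 1‖ + ‖A ⁅γ, η⁆ - 1‖) * ‖a η‖ := by
  have h : a ⁅γ, η⁆ = -(A γ * (A η - 1) * A γ⁻¹) (a γ) +
      ((A γ - 1) - (A ⁅γ, η⁆ - 1)) (a η) := by
    rw [linear_conj, commutatorElement_def, hA.cocycle, hA.cocycle, hA.cocycle, hA.map_inv, hA.map_inv]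
    simp only [map_mul, map_neg, sub_apply, mul_apply_eq_comp,
      one_apply_eq_self]
    abel
  rw [h]
  refine (norm_add_le _ _).trans (add_le_add ?_ ?_)
  · rw [norm_neg]
    exact ContinuousLinearMap.le_of_opNorm_le _
      ((hA.norm_mul_right_le _ _).trans (hA.norm_mul_le _ _)) _
  · exact ContinuousLinearMap.le_of_opNorm_le _ (norm_sub_le _ _) _

/-- If `A γ` commutes with the commutator `[A γ, A η]`, then the powers of the latter are the
commutators `[(A γ)^k, A η]`, all of which are close to the identity. -/
theorem linear_commutator_eq_one (hA : IsAffineAction A a) {γ η : Γ} (hη : ‖A η - 1‖ ≤ 1 / 4)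
    (h : A ⁅γ, ⁅γ, η⁆⁆ = 1) : A ⁅γ, η⁆ = 1 := by
  have hc : A γ * A ⁅γ, η⁆ = A ⁅γ, η⁆ * A γ := by
    have : γ * ⁅γ, η⁆ = ⁅γ, ⁅γ, η⁆⁆ * (⁅γ, η⁆ * γ) := by
      rw [commutatorElement_def γ ⁅γ, η⁆]; group
    rw [← map_mul, this, map_mul, h, one_mul, map_mul]
  have hpow : ∀ k : ℕ, A (γ ^ k * η * (γ ^ k)⁻¹) = A ⁅γ, η⁆ ^ k * A η := by
    intro k
    induction k with
    | zero => simp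
    | succ k ih =>
      have h1 : γ ^ (k + 1) * η * (γ ^ (k + 1))⁻¹ = γ * (γ ^ k * η * (γ ^ k)⁻¹) * γ⁻¹ := by
        rw [pow_succ']; group
      have h2 : A γ * A η * A γ⁻¹ = A ⁅γ, η⁆ * A η := by
        rw [← map_mul, ← map_mul, ← map_mul, commutatorElement_def]; congr 1; group
      have hc' : Commute (A γ) (A ⁅γ, η⁆ ^ k) := Commute.pow_right hc k
      rw [h1, map_mul, map_mul, ih, ← mul_assoc, hc'.eq, mul_assoc (_ ^ k), mul_assoc (_ ^ k), h2,
        ← mul_assoc, ← pow_succ]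
  refine eq_one_of_forall_norm_pow_sub_one_le fun k => ?_
  have h1 : A ⁅γ, η⁆ ^ k - 1 =
      (A (γ ^ k) * (A η - 1) * A (γ ^ k)⁻¹ - (A η - 1)) * A η⁻¹ := by
    rw [linear_conj, hpow]
    have := map_mul_inv (A := A) η
    calc A ⁅γ, η⁆ ^ k - 1 = A ⁅γ, η⁆ ^ k * (A η * A η⁻¹) - A η * A η⁻¹ := by rw [this, mul_one]
      _ = _ := by noncomm_ring
  rw [h1]
  refine (hA.norm_mul_right_le _ _).trans ((norm_sub_le _ _).trans ?_)
  have h2 := (hA.norm_mul_right_le (γ ^ k)⁻¹ (A (γ ^ k) * (A η - 1))).trans (hA.norm_mul_le _ _)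
  linarith

/-- Under discreteness, elements with linear part close to the identity have commuting linear
parts: iterated commutators with `γ` have bounded translation parts and linear parts tending to
the identity, so that their linear parts eventually are the identity. -/
theorem linear_commutator_eq_one_of_finite (hA : IsAffineAction A a)
    (hfin : ∀ R : ℝ, {γ | ‖a γ‖ ≤ R}.Finite) {γ η : Γ} (hγ : ‖A γ - 1‖ ≤ 1 / 4)
    (hη : ‖A η - 1‖ ≤ 1 / 4) : A ⁅γ, η⁆ = 1 := by
  set c : ℕ → Γ := fun k => (fun x => ⁅γ, x⁆)^[k] η with hc
  have hc0 : c 0 = η := rfl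
  have hcs : ∀ k, c (k + 1) = ⁅γ, c k⁆ := fun k => Function.iterate_succ_apply' _ _ _
  have hlin : ∀ k, ‖A (c k) - 1‖ ≤ 1 / 4 * (1 / 2) ^ k := by
    intro k
    induction k with
    | zero => rwa [hc0, pow_zero, mul_one]
    | succ k ih =>
      rw [hcs, pow_succ]
      have := hA.norm_linear_commutator_le γ (c k)
      nlinarith [norm_nonneg (A (c k) - 1)]
  have hquarter : ∀ k, ‖A (c k) - 1‖ ≤ 1 / 4 := fun k =>
    (hlin k).trans (mul_le_of_le_one_right (by norm_num) (pow_le_one₀ (by norm_num) (by norm_num)))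
  have htrans : ∀ k, ‖a (c k)‖ ≤ ‖a γ‖ + ‖a η‖ := by
    intro k
    induction k with
    | zero => rw [hc0]; linarith [norm_nonneg (a γ)]
    | succ k ih =>
      have h1 := hA.norm_translation_commutator_le γ (c k)
      have h2 := hquarter (k + 1)
      have h3 := hquarter k
      rw [hcs] at h2 ⊢
      have h4 : ‖A (c k) - 1‖ * ‖a γ‖ ≤ 1 / 4 * ‖a γ‖ := by gcongr
      have h5 : (‖A γ - 1‖ + ‖A ⁅γ, c k⁆ - 1‖) * ‖a (c k)‖ ≤ (1 / 4 + 1 / 4) * ‖a (c k)‖ := by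
        gcongr
      linarith [norm_nonneg (a γ), norm_nonneg (a η)]
  -- The values `c k` lie in a finite set, while their linear parts tend to the identity.
  obtain ⟨k, hk⟩ : ∃ k, A (c k) = 1 := by
    by_contra! hne
    have hS : (Set.range fun k => ‖A (c k) - 1‖).Finite :=
      ((hfin (‖a γ‖ + ‖a η‖)).image fun x => ‖A x - 1‖).subset <| by
        rintro _ ⟨k, rfl⟩
        exact ⟨c k, htrans k, rfl⟩
    obtain ⟨_, ⟨m, rfl⟩, hmin⟩ := Set.exists_min_image _ id hS ⟨_, 0, rfl⟩
    have hm : 0 < ‖A (c m) - 1‖ := norm_pos_iff.2 (sub_ne_zero.2 (hne m))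
    obtain ⟨n, hn⟩ := exists_pow_lt_of_lt_one hm (by norm_num : (1 / 2 : ℝ) < 1)
    have h1 := hmin _ ⟨n, rfl⟩
    have h2 := hlin n
    have h3 : (0 : ℝ) < (1 / 2) ^ n := by positivity
    simp only [id] at h1
    linarith
  have hdown : ∀ k, A (c (k + 1)) = 1 → A (c 1) = 1 := by
    intro k
    induction k with
    | zero => exact id
    | succ k ih =>
      intro h
      refine ih ?_
      rw [hcs (k + 1), hcs k] at h
      rw [hcs]
      exact hA.linear_commutator_eq_one (hquarter k) h
  have : A (c (k + 1)) = 1 := by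
    rw [hcs]
    have := hA.norm_linear_commutator_le γ (c k)
    rw [hk, sub_self, norm_zero, mul_zero] at this
    exact sub_eq_zero.1 (norm_le_zero_iff.1 this)
  simpa [hcs, hc0] using hdown k this

/-- An element of finite order fixes the barycentre of each of its orbits. -/
theorem exists_fixed_of_pow_eq_one (hA : IsAffineAction A a) {γ : Γ} {m : ℕ} (hm : 0 < m)
    (hγ : γ ^ m = 1) (p : V) :
    A γ ((m : ℝ)⁻¹ • ∑ i ∈ Finset.range m, (A (γ ^ i) p + a (γ ^ i))) + a γ =
      (m : ℝ)⁻¹ • ∑ i ∈ Finset.range m, (A (γ ^ i) p + a (γ ^ i)) := by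
  have hm' : (m : ℝ) ≠ 0 := by positivity
  have h1 : ∀ i, A γ (A (γ ^ i) p + a (γ ^ i)) = A (γ ^ (i + 1)) p + a (γ ^ (i + 1)) - a γ := by
    intro i
    rw [pow_succ', map_mul, hA.cocycle, map_add, mul_apply_eq_comp]; abel
  have h2 : ∑ i ∈ Finset.range m, (A (γ ^ (i + 1)) p + a (γ ^ (i + 1))) =
      ∑ i ∈ Finset.range m, (A (γ ^ i) p + a (γ ^ i)) := by
    have h3 := Finset.sum_range_succ (fun i => A (γ ^ i) p + a (γ ^ i)) m
    rw [Finset.sum_range_succ', hγ, pow_zero] at h3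
    exact add_right_cancel h3
  rw [map_smul, map_sum]
  simp only [h1]
  rw [Finset.sum_sub_distrib, h2, Finset.sum_const, Finset.card_range, smul_sub,
    ← Nat.cast_smul_eq_nsmul ℝ, smul_smul, inv_mul_cancel₀ hm', one_smul, sub_add_cancel]

theorem iterate_act (hA : IsAffineAction A a) (γ : Γ) (n : ℕ) (p : V) :
    (fun x => A γ x + a γ)^[n] p = A (γ ^ n) p + a (γ ^ n) := by
  induction n with
  | zero => simp [hA.map_one]
  | succ n ih =>
    rw [Function.iterate_succ_apply', ih, pow_succ', map_mul, hA.cocycle, map_add,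
      mul_apply_eq_comp]
    abel

theorem pow_fixed (hA : IsAffineAction A a) {γ : Γ} {p : V} (hp : A γ p + a γ = p) (n : ℕ) :
    A (γ ^ n) p + a (γ ^ n) = p := by
  rw [← hA.iterate_act]
  exact Function.iterate_fixed hp n

theorem norm_translation_le_of_fixed (hA : IsAffineAction A a) {γ : Γ} {p : V}
    (hp : A γ p + a γ = p) : ‖a γ‖ ≤ 2 * ‖p‖ := by
  have h1 : a γ = p - A γ p := eq_sub_of_add_eq' hp
  have h2 := (A γ).le_of_opNorm_le (hA.norm_le γ) p
  rw [h1]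
  linarith [norm_sub_le p (A γ p)]

theorem isOfFinOrder_of_fixed (hA : IsAffineAction A a)
    (hfin : ∀ R : ℝ, {γ | ‖a γ‖ ≤ R}.Finite) {γ : Γ} {p : V} (hp : A γ p + a γ = p) :
    IsOfFinOrder γ := by
  by_contra h
  refine Set.infinite_range_of_injective (injective_pow_iff_not_isOfFinOrder.2 h)
    ((hfin (2 * ‖p‖)).subset ?_)
  rintro _ ⟨n, rfl⟩
  exact hA.norm_translation_le_of_fixed (hA.pow_fixed hp n)

/-- Commuting elements of finite order of an affine action on a finite-dimensional space have a
common fixed point. -/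
theorem exists_common_fixed [FiniteDimensional ℝ V] (hA : IsAffineAction A a) (U : Set Γ)
    (hU : ∀ γ ∈ U, ∀ η ∈ U, Function.Commute (fun x => A γ x + a γ) fun x => A η x + a η)
    (hord : ∀ γ ∈ U, IsOfFinOrder γ) :
    ∃ p : V, ∀ γ ∈ U, A γ p + a γ = p := by
  classical
  -- Finite subsets are dealt with one element at a time, using barycentres of orbits.
  have hex : ∀ S : Finset Γ, (S : Set Γ) ⊆ U → ∃ p : V, ∀ γ ∈ S, A γ p + a γ = p := by
    intro S
    induction S using Finset.induction_on with
    | empty => exact fun _ => ⟨0, by simp⟩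
    | insert γ S _ ih =>
      intro hS
      rw [Finset.coe_insert, Set.insert_subset_iff] at hS
      obtain ⟨p, hp⟩ := ih hS.2
      obtain ⟨m, hm, hγ⟩ := (isOfFinOrder_iff_pow_eq_one.1 (hord γ hS.1))
      refine ⟨(m : ℝ)⁻¹ • ∑ i ∈ Finset.range m, (A (γ ^ i) p + a (γ ^ i)), fun η hη => ?_⟩
      rcases Finset.mem_insert.1 hη with rfl | hη
      · exact hA.exists_fixed_of_pow_eq_one hm hγ p
      have hm' : (m : ℝ) ≠ 0 := by positivity
      have h1 : ∀ i, A η (A (γ ^ i) p + a (γ ^ i)) = A (γ ^ i) p + a (γ ^ i) - a η := by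
        intro i
        have hc := ((hU η (hS.2 hη) γ hS.1).iterate_right i).eq p
        rw [hp η hη, hA.iterate_act] at hc
        exact eq_sub_of_add_eq hc
      rw [map_smul, map_sum]
      simp only [h1]
      rw [Finset.sum_sub_distrib, Finset.sum_const, Finset.card_range, smul_sub,
        ← Nat.cast_smul_eq_nsmul ℝ, smul_smul, inv_mul_cancel₀ hm', one_smul, sub_add_cancel]
  -- A finite subset whose fixed space has least dimension has the same fixed points as `U`.
  let W : Finset Γ → Submodule ℝ V := fun S =>
    ⨅ γ ∈ S, LinearMap.ker ((A γ - 1 : V →L[ℝ] V) : V →ₗ[ℝ] V)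
  have hW : ∀ S v, v ∈ W S ↔ ∀ γ ∈ S, A γ v = v := by
    intro S v
    simp [W, Submodule.mem_iInf, sub_eq_zero]
  obtain ⟨S, hS, hmin⟩ : ∃ S : Finset Γ, (S : Set Γ) ⊆ U ∧ ∀ T : Finset Γ, (T : Set Γ) ⊆ U →
      Module.finrank ℝ (W S) ≤ Module.finrank ℝ (W T) := by
    have hne : ({S : Finset Γ | (S : Set Γ) ⊆ U} : Set (Finset Γ)).Nonempty := ⟨∅, by simp⟩
    exact ⟨_, Function.argminOn_mem (fun S => Module.finrank ℝ (W S)) _ hne,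
      fun T hT => Function.argminOn_le (fun S => Module.finrank ℝ (W S)) _ hT⟩
  obtain ⟨p, hp⟩ := hex S hS
  refine ⟨p, fun γ hγ => ?_⟩
  have hT : ((insert γ S : Finset Γ) : Set Γ) ⊆ U := by
    rw [Finset.coe_insert]; exact Set.insert_subset hγ hS
  obtain ⟨q, hq⟩ := hex _ hT
  have hle : W (insert γ S) ≤ W S := fun v hv =>
    (hW _ _).2 fun η hη => (hW _ _).1 hv η (Finset.mem_insert_of_mem hη)
  have heq := Submodule.eq_of_le_of_finrank_le hle (hmin _ hT)
  have hpq : p - q ∈ W S := (hW _ _).2 fun η hη => by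
    rw [map_sub, eq_sub_of_add_eq (hp η hη), eq_sub_of_add_eq (hq η (Finset.mem_insert_of_mem hη))]
    abel
  rw [← heq] at hpq
  have h1 := (hW _ _).1 hpq γ (Finset.mem_insert_self _ _)
  have h2 := hq γ (Finset.mem_insert_self _ _)
  rw [map_sub] at h1
  calc A γ p + a γ = (A γ p - A γ q) + (A γ q + a γ) := by abel
    _ = p := by rw [h1, h2]; abel

/-- A discrete group of affine isometries each of whose elements has a fixed point is finite.
If it were infinite, there would be infinitely many elements with linear part close to the
identity; these commute because their commutators are translations with a fixed point, and hence
they have a common fixed point. -/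
theorem finite_of_forall_exists_fixed [FiniteDimensional ℝ V] (hA : IsAffineAction A a)
    (hfin : ∀ R : ℝ, {γ | ‖a γ‖ ≤ R}.Finite) (hfix : ∀ γ, ∃ p, A γ p + a γ = p) : Finite Γ := by
  by_contra hinf
  rw [not_finite_iff_infinite] at hinf
  set U : Set Γ := {γ | ‖A γ - 1‖ ≤ 1 / 4} with hUdef
  have hUinf : U.Infinite := by
    have htb : TotallyBounded (Metric.closedBall (0 : V →L[ℝ] V) 1) :=
      (isCompact_closedBall _ _).totallyBounded
    obtain ⟨t, ht, hcov⟩ := Metric.totallyBounded_iff.1 htb (1 / 8) (by norm_num)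
    have hmem : ∀ γ : Γ, ∃ y : t, A γ ∈ Metric.ball (y : V →L[ℝ] V) (1 / 8) := by
      intro γ
      have := hcov (mem_closedBall_zero_iff.2 (hA.norm_le γ))
      simpa using this
    choose f hf using hmem
    have := ht.to_subtype
    obtain ⟨y, hy⟩ := Finite.exists_infinite_fiber f
    rw [Set.infinite_coe_iff] at hy
    obtain ⟨γ₀, hγ₀⟩ := hy.nonempty
    refine (hy.image (mul_right_injective γ₀⁻¹).injOn).mono ?_
    rintro _ ⟨γ, hγ, rfl⟩
    have h1 : A (γ₀⁻¹ * γ) - 1 = A γ₀⁻¹ * (A γ - A γ₀) := by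
      rw [mul_sub, ← map_mul, ← map_mul, inv_mul_cancel, MonoidHom.map_one]
    change ‖A (γ₀⁻¹ * γ) - 1‖ ≤ 1 / 4
    rw [h1]
    refine (hA.norm_mul_le _ _).trans ?_
    have h2 := hf γ
    have h3 := hf γ₀
    rw [Set.mem_preimage, Set.mem_singleton_iff] at hγ hγ₀
    rw [hγ] at h2
    rw [hγ₀] at h3
    rw [Metric.mem_ball] at h2 h3
    rw [← dist_eq_norm]
    linarith [dist_triangle_right (A γ) (A γ₀) y]
  have hcomm : ∀ γ ∈ U, ∀ η ∈ U,
      Function.Commute (fun x => A γ x + a γ) fun x => A η x + a η := by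
    intro γ hγ η hη x
    have h1 := hA.linear_commutator_eq_one_of_finite hfin hγ hη
    obtain ⟨p, hp⟩ := hfix ⁅γ, η⁆
    have h2 : a ⁅γ, η⁆ = 0 := by
      rw [h1] at hp
      simpa using hp
    have hmul : ∀ γ η : Γ, A γ (A η x + a η) + a γ = A (γ * η) x + a (γ * η) := fun γ η => by
      rw [map_mul, hA.cocycle, map_add, mul_apply_eq_comp]; abel
    have h3 : γ * η = ⁅γ, η⁆ * (η * γ) := by rw [commutatorElement_def]; group
    change A γ (A η x + a η) + a γ = A η (A γ x + a γ) + a η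
    rw [hmul, hmul, h3, map_mul A ⁅γ, η⁆, hA.cocycle ⁅γ, η⁆, h1, h2, one_mul, zero_add,
      one_apply_eq_self]
  obtain ⟨p, hp⟩ := hA.exists_common_fixed U hcomm fun γ _ =>
    let ⟨_, hq⟩ := hfix γ; hA.isOfFinOrder_of_fixed hfin hq
  exact hUinf ((hfin (2 * ‖p‖)).subset fun γ hγ => hA.norm_translation_le_of_fixed (hp γ hγ))

end IsAffineAction

end Euclidean

/-! ### Stabilizers of boundary points -/

/-- An action by isometries on a real normed space is affine, by the Mazur–Ulam theorem. -/
theorem exists_isAffineAction_of_isometric {V : Type*} [NormedAddCommGroup V] [NormedSpace ℝ V]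
    {Γ : Type*} [Group Γ] (φ : Γ →* (V ≃ᵢ V)) :
    ∃ (A : Γ →* (V →L[ℝ] V)) (a : Γ → V), IsAffineAction A a ∧ ∀ γ x, A γ x + a γ = φ γ x := by
  have hmap : ∀ γ x, (φ γ).toRealLinearIsometryEquiv x = φ γ x - φ γ 0 := fun γ x =>
    IsometryEquiv.toRealLinearIsometryEquiv_apply _ _
  have happ : ∀ γ η x, φ (γ * η) x = φ γ (φ η x) := fun γ η x => by rw [map_mul]; rfl
  refine ⟨⟨⟨fun γ => ((φ γ).toRealLinearIsometryEquiv : V →L[ℝ] V), ?_⟩, ?_⟩,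
    fun γ => φ γ 0, ⟨fun γ => ?_, fun γ η => ?_⟩, fun γ x => ?_⟩
  · ext x
    change (φ 1).toRealLinearIsometryEquiv x = x
    rw [hmap, map_one]
    exact sub_zero x
  · intro γ η
    ext x
    change (φ (γ * η)).toRealLinearIsometryEquiv x =
      (φ γ).toRealLinearIsometryEquiv ((φ η).toRealLinearIsometryEquiv x)
    rw [hmap η, map_sub, hmap, hmap, hmap, happ, happ, sub_sub_sub_cancel_right]
  · exact (φ γ).toRealLinearIsometryEquiv.toLinearIsometry.norm_toContinuousLinearMap_le
  · change φ (γ * η) 0 = φ γ 0 + (φ γ).toRealLinearIsometryEquiv (φ η 0)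
    rw [hmap, happ, add_sub_cancel]
  · change (φ γ).toRealLinearIsometryEquiv x + φ γ 0 = φ γ x
    rw [hmap, sub_add_cancel]

/-- Stereographic projection from `ζ`, written as the inverse of a parametrization of the sphere
minus `ζ`; it distorts distances by the factor familiar from inversions. -/
theorem exists_stereographic {ζ : Ball N} (hζ : ζ ∈ sphere N) :
    ∃ c : (ℝ ∙ (ζ : EuclideanSpace ℝ (Fin (N + 1))))ᗮ → Ball N,
      (∀ v, c v ∈ sphere N) ∧ (∀ v, c v ≠ ζ) ∧ (∀ x ∈ sphere N, x ≠ ζ → ∃ v, c v = x) ∧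
      (∀ v, ‖(c v : EuclideanSpace ℝ (Fin (N + 1))) - ζ‖ ^ 2 * (‖v‖ ^ 2 + 1 / 4) = 1) ∧
      ∀ v w, ‖(c v : EuclideanSpace ℝ (Fin (N + 1))) - c w‖ =
        ‖v - w‖ * (‖(c v : EuclideanSpace ℝ (Fin (N + 1))) - ζ‖ *
          ‖(c w : EuclideanSpace ℝ (Fin (N + 1))) - ζ‖) := by
  set z : EuclideanSpace ℝ (Fin (N + 1)) := ζ.1
  have hz1 : ‖z‖ = 1 := hζ
  -- `u` runs through the image of the sphere under the inversion centred at `ζ`.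
  let u : (ℝ ∙ z)ᗮ → EuclideanSpace ℝ (Fin (N + 1)) := fun v => v - (1 / 2 : ℝ) • z
  have hperp : ∀ v : (ℝ ∙ z)ᗮ, inner ℝ (v : EuclideanSpace ℝ (Fin (N + 1))) z = 0 := fun v => by
    rw [real_inner_comm]
    exact Submodule.mem_orthogonal_singleton_iff_inner_right.1 v.2
  have hu : ∀ v, ‖u v‖ ^ 2 = ‖v‖ ^ 2 + 1 / 4 := fun v => by
    simp only [u]
    rw [norm_sub_sq_real, inner_smul_right, hperp, norm_smul, hz1]
    norm_num
  have hu0 : ∀ v, 0 < ‖u v‖ := fun v => by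
    have := hu v
    by_contra h
    rw [(norm_nonneg (u v)).antisymm' (not_lt.1 h)] at this
    nlinarith [sq_nonneg ‖v‖]
  have huz : ∀ v, inner ℝ (u v) z = -(1 / 2) := fun v => by
    simp only [u]
    rw [inner_sub_left, inner_smul_left, hperp, real_inner_self_eq_norm_sq, hz1]
    simp
  have hc : ∀ v, ‖z + (1 / ‖u v‖) ^ 2 • u v‖ = 1 := fun v => by
    have h1 : ‖z + (1 / ‖u v‖) ^ 2 • u v‖ ^ 2 = 1 := by
      rw [norm_add_sq_real, inner_smul_right, real_inner_comm, huz, norm_smul, hz1, mul_pow]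
      have := (hu0 v).ne'
      rw [Real.norm_of_nonneg (by positivity)]
      field_simp
      ring
    exact (pow_eq_one_iff_of_nonneg (norm_nonneg _) two_ne_zero).1 h1
  let c : (ℝ ∙ z)ᗮ → Ball N := fun v =>
    ⟨z + (1 / ‖u v‖) ^ 2 • u v, mem_closedBall_zero_iff.2 (hc v).le⟩
  have hcz : ∀ v, ‖(c v : EuclideanSpace ℝ (Fin (N + 1))) - z‖ = 1 / ‖u v‖ := fun v => by
    have := (hu0 v).ne'
    simp only [c]
    rw [add_sub_cancel_left, norm_smul, Real.norm_of_nonneg (by positivity)]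
    field_simp
  refine ⟨c, hc, fun v h => ?_, fun x hx hne => ?_, fun v => ?_, fun v w => ?_⟩
  · have h1 := hcz v
    rw [h, sub_self, norm_zero] at h1
    exact (one_div_pos.2 (hu0 v)).ne h1
  · have hx1 : ‖(x : EuclideanSpace ℝ (Fin (N + 1)))‖ = 1 := hx
    have hw : 0 < ‖(x : EuclideanSpace ℝ (Fin (N + 1))) - z‖ :=
      norm_pos_iff.2 fun h => hne (Subtype.ext (sub_eq_zero.1 h))
    have hw2 : ‖(x : EuclideanSpace ℝ (Fin (N + 1))) - z‖ ^ 2 =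
        2 - 2 * inner ℝ (x : EuclideanSpace ℝ (Fin (N + 1))) z := by
      rw [norm_sub_sq_real, hx1, hz1]; ring
    set w := (x : EuclideanSpace ℝ (Fin (N + 1))) - z with hwdef
    have hv : (1 / ‖w‖) ^ 2 • w + (1 / 2 : ℝ) • z ∈ (ℝ ∙ z)ᗮ := by
      rw [Submodule.mem_orthogonal_singleton_iff_inner_left, inner_add_left, inner_smul_left,
        inner_smul_left, real_inner_self_eq_norm_sq, hz1, hwdef, inner_sub_left,
        real_inner_self_eq_norm_sq, hz1, ← hwdef, div_pow, hw2]
      have h2 : 0 < 2 - 2 * inner ℝ (x : EuclideanSpace ℝ (Fin (N + 1))) z := hw2 ▸ pow_pos hw 2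
      have h3 : 1 - inner ℝ (x : EuclideanSpace ℝ (Fin (N + 1))) z ≠ 0 := by linarith
      have h4 : 2 - 2 * inner ℝ (x : EuclideanSpace ℝ (Fin (N + 1))) z =
          2 * (1 - inner ℝ (x : EuclideanSpace ℝ (Fin (N + 1))) z) := by ring
      rw [h4]
      simp only [conj_trivial]
      field_simp
      ring
    refine ⟨⟨_, hv⟩, Subtype.ext ?_⟩
    have hu' : u ⟨_, hv⟩ = (1 / ‖w‖) ^ 2 • w := by simp [u]
    have hn : ‖(1 / ‖w‖) ^ 2 • w‖ = 1 / ‖w‖ := by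
      rw [norm_smul, Real.norm_of_nonneg (by positivity)]
      field_simp
    change z + (1 / ‖u ⟨_, hv⟩‖) ^ 2 • u ⟨_, hv⟩ = x
    rw [hu', hn, smul_smul]
    have : (1 / (1 / ‖w‖)) ^ 2 * (1 / ‖w‖) ^ 2 = 1 := by field_simp
    rw [this, one_smul, hwdef, add_sub_cancel]
  · have := (hu0 v).ne'
    rw [hcz, ← hu]
    field_simp
  · rw [hcz, hcz]
    have h1 := dist_div_norm_sq_smul (norm_pos_iff.1 (hu0 v)) (norm_pos_iff.1 (hu0 w)) 1
    have h2 : ‖v - w‖ = dist (u v) (u w) := by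
      rw [dist_eq_norm]; simp [u]
    have h3 : ‖(c v : EuclideanSpace ℝ (Fin (N + 1))) - c w‖ =
        dist ((1 / ‖u v‖) ^ 2 • u v) ((1 / ‖u w‖) ^ 2 • u w) := by
      rw [dist_eq_norm]; simp only [c]; rw [add_sub_add_left_eq_sub]
    rw [h3, h1, h2]
    have := (hu0 v).ne'
    have := (hu0 w).ne'
    field_simp

/-- A group of conformal maps fixing `ζ` with derivative one acts by Euclidean isometries in the
stereographic projection from `ζ`, and inherits discreteness. -/
theorem exists_isAffineAction_of_fixes {ζ : Ball N} (hζ : ζ ∈ sphere N)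
    (Γ : Subgroup (Ball N ≃ₜ Ball N)) (hΓ : ∀ g ∈ Γ, IsConformal g) (hfix : ∀ g ∈ Γ, g ζ = ζ)
    (hj : ∀ g ∈ Γ, conformalDeriv g ζ = 1)
    (hfin : ∀ r : ℝ, 0 < r → {g : Γ | r ≤ conformalDeriv (g : Ball N ≃ₜ Ball N) (origin N)}.Finite) :
    ∃ (A : Γ →* ((ℝ ∙ (ζ : EuclideanSpace ℝ (Fin (N + 1))))ᗮ →L[ℝ]
        (ℝ ∙ (ζ : EuclideanSpace ℝ (Fin (N + 1))))ᗮ)) (a : Γ → _),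
      IsAffineAction A a ∧ (∀ R : ℝ, {γ | ‖a γ‖ ≤ R}.Finite) ∧
      ∀ γ : Γ, (∃ p, A γ p + a γ = p) ↔
        ∃ x ∈ sphere N, x ≠ ζ ∧ (γ : Ball N ≃ₜ Ball N) x = x := by
  obtain ⟨c, hcs, hcne, hcsurj, hcζ, hcdist⟩ := exists_stereographic hζ
  have hpos : ∀ v, 0 < ‖(c v : EuclideanSpace ℝ (Fin (N + 1))) - ζ‖ := fun v =>
    norm_pos_iff.2 fun h => hcne v (Subtype.ext (sub_eq_zero.1 h))
  have hcinj : Function.Injective c := fun v w h => by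
    have h1 := hcdist v w
    rw [h, sub_self, norm_zero] at h1
    have h2 := mul_eq_zero.1 h1.symm
    exact sub_eq_zero.1 (norm_eq_zero.1
      (h2.resolve_right (mul_pos (h ▸ hpos w) (hpos w)).ne'))
  have hmap : ∀ (g : Γ) v, ∃ w, c w = (g : Ball N ≃ₜ Ball N) (c v) := fun g v =>
    hcsurj _ (((hΓ g g.2).map_sphere _).2 (hcs v)) fun h =>
      hcne v ((g : Ball N ≃ₜ Ball N).injective (h.trans (hfix g g.2).symm))
  choose T hT using hmap
  have hT1 : ∀ v, T 1 v = v := fun v => hcinj (hT 1 v)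
  have hTmul : ∀ g h v, T (g * h) v = T g (T h v) := fun g h v => hcinj <| by
    rw [hT, hT, hT]; rfl
  have hTζ : ∀ g v, ‖(c (T g v) : EuclideanSpace ℝ (Fin (N + 1))) - ζ‖ ^ 2 =
      conformalDeriv (g : Ball N ≃ₜ Ball N) (c v) *
        ‖(c v : EuclideanSpace ℝ (Fin (N + 1))) - ζ‖ ^ 2 := fun g v => by
    have h1 := (hΓ g g.2).normSq_map_sub (c v) ζ
    rwa [hfix g g.2, hj g g.2, mul_one, ← hT] at h1
  have hTiso : ∀ g, Isometry (T g) := fun g => Isometry.of_dist_eq fun v w => by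
    rw [dist_eq_norm, dist_eq_norm]
    have h1 := (hΓ g g.2).normSq_map_sub (c v) (c w)
    rw [← hT, ← hT, hcdist, hcdist, mul_pow, mul_pow, hTζ, hTζ] at h1
    have h2 := (hΓ g g.2).conformalDeriv_pos (c v)
    have h3 := (hΓ g g.2).conformalDeriv_pos (c w)
    have h4 := hpos v
    have h5 := hpos w
    have h6 : ‖T g v - T g w‖ ^ 2 = ‖v - w‖ ^ 2 := by
      field_simp at h1
      exact h1
    exact (pow_left_inj₀ (norm_nonneg _) (norm_nonneg _) two_ne_zero).1 h6
  let φ : Γ →* ((ℝ ∙ (ζ : EuclideanSpace ℝ (Fin (N + 1))))ᗮ ≃ᵢ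
      (ℝ ∙ (ζ : EuclideanSpace ℝ (Fin (N + 1))))ᗮ) :=
    { toFun := fun g =>
        ⟨⟨T g, T g⁻¹, fun v => by rw [← hTmul, inv_mul_cancel, hT1],
          fun v => by rw [← hTmul, mul_inv_cancel, hT1]⟩, hTiso g⟩
      map_one' := IsometryEquiv.ext hT1
      map_mul' := fun g h => IsometryEquiv.ext (hTmul g h) }
  obtain ⟨A, a, hA, hAφ⟩ := exists_isAffineAction_of_isometric φ
  have hAT : ∀ γ x, A γ x + a γ = T γ x := hAφ
  refine ⟨A, a, hA, fun R => ?_, fun γ => ⟨?_, ?_⟩⟩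
  · have ha : ∀ γ, a γ = T γ 0 := fun γ => by rw [← hAT, map_zero, zero_add]
    -- The derivatives at `ζ` and `c 0` are bounded below, which keeps `γ⁻¹(0)` inside a smaller ball.
    refine (hfin (1 / (2 * (1 + (4 * R ^ 2 + 1)))) (by positivity)).subset fun γ hγ => ?_
    have hγ' : ‖T γ 0‖ ^ 2 ≤ R ^ 2 := by
      rw [← ha]; exact pow_le_pow_left₀ (norm_nonneg _) hγ 2
    have h0 := hcζ 0
    have h1 := hcζ (T γ 0)
    rw [hTζ] at h1
    have hd : ‖(c 0 : EuclideanSpace ℝ (Fin (N + 1))) - ζ‖ ^ 2 = 4 := by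
      rw [norm_zero] at h0; linarith
    rw [hd] at h1
    have hjpos := (hΓ γ γ.2).conformalDeriv_pos (c 0)
    have h2 : 1 ≤ conformalDeriv (γ : Ball N ≃ₜ Ball N) (c 0) * (4 * R ^ 2 + 1) := by nlinarith
    have h3 := hj γ γ.2
    have ham := (hΓ γ γ.2).symm_origin_mem
    have hq := one_sub_normSq_pos ham
    rw [conformalDeriv_eq_ballPoissonKernel _ (hcs 0)] at h2
    rw [conformalDeriv_eq_ballPoissonKernel _ hζ] at h3
    change _ ≤ conformalDeriv _ _
    rw [conformalDeriv_origin]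
    unfold ballPoissonKernel at h2 h3
    have hne : ∀ x ∈ sphere N, 0 < ‖(x : EuclideanSpace ℝ (Fin (N + 1))) -
        (γ : Ball N ≃ₜ Ball N).symm (origin N)‖ ^ 2 := fun x hx => by
      have := ballPoissonKernel_pos ham hx
      unfold ballPoissonKernel at this
      exact (div_pos_iff_of_pos_left hq).1 this
    have hn1 := hne _ hζ
    have hn2 := hne _ (hcs 0)
    rw [div_eq_one_iff_eq hn1.ne'] at h3
    rw [div_mul_eq_mul_div, le_div_iff₀ hn2, one_mul] at h2
    have htri := norm_sub_le_norm_sub_add_norm_sub (c 0 : EuclideanSpace ℝ (Fin (N + 1)))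
      ((γ : Ball N ≃ₜ Ball N).symm (origin N)) ζ
    rw [norm_sub_rev ((γ : Ball N ≃ₜ Ball N).symm (origin N) : EuclideanSpace ℝ (Fin (N + 1)))]
      at htri
    have htri2 := pow_le_pow_left₀ (norm_nonneg _) htri 2
    rw [hd] at htri2
    rw [div_le_iff₀ (by positivity)]
    nlinarith [sq_nonneg (‖(c 0 : EuclideanSpace ℝ (Fin (N + 1))) -
      (γ : Ball N ≃ₜ Ball N).symm (origin N)‖ - ‖(ζ : EuclideanSpace ℝ (Fin (N + 1))) -
      (γ : Ball N ≃ₜ Ball N).symm (origin N)‖)]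
  · rintro ⟨p, hp⟩
    rw [hAT] at hp
    exact ⟨c p, hcs p, hcne p, by rw [← hT, hp]⟩
  · rintro ⟨x, hx, hne, hγ⟩
    obtain ⟨p, rfl⟩ := hcsurj x hx hne
    exact ⟨p, by rw [hAT]; exact hcinj (by rw [hT, hγ])⟩

/-- If the stabilizer of `ζ` in a discrete group consists of maps with derivative one at `ζ`, then
`ζ` is a parabolic fixed point exactly if the stabilizer is infinite. -/
theorem isParabolicFixedPoint_iff_infinite {ζ : Ball N} (hζ : ζ ∈ sphere N)
    (G : Subgroup (Ball N ≃ₜ Ball N)) (hG : ∀ g ∈ G, IsConformal g)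
    (hj : ∀ g ∈ G, g ζ = ζ → conformalDeriv g ζ = 1)
    (hfin : ∀ r : ℝ, 0 < r → {g : G | r ≤ conformalDeriv (g : Ball N ≃ₜ Ball N) (origin N)}.Finite) :
    IsParabolicFixedPoint G ζ ↔ {g : G | (g : Ball N ≃ₜ Ball N) ζ = ζ}.Infinite := by
  let Γ : Subgroup (Ball N ≃ₜ Ball N) :=
    { carrier := {g | g ∈ G ∧ g ζ = ζ}
      one_mem' := ⟨G.one_mem, rfl⟩
      mul_mem' := fun {g h} hg hh => ⟨G.mul_mem hg.1 hh.1, by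
        change g (h ζ) = ζ
        rw [hh.2, hg.2]⟩
      inv_mem' := fun {g} hg => ⟨G.inv_mem hg.1, by
        change g.symm ζ = ζ
        rw [g.symm_apply_eq, hg.2]⟩ }
  have hle : Γ ≤ G := fun g hg => hg.1
  obtain ⟨A, a, hA, hAfin, hAfix⟩ := exists_isAffineAction_of_fixes hζ Γ (fun g hg => hG g hg.1)
    (fun g hg => hg.2) (fun g hg => hj g hg.1 hg.2)
    (fun r hr => (hfin r hr).preimage (f := Subgroup.inclusion hle)
      (Subgroup.inclusion_injective hle).injOn)
  have hpar : ∀ γ : Γ, IsParabolic (γ : Ball N ≃ₜ Ball N) ↔ ¬ ∃ p, A γ p + a γ = p := by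
    intro γ
    rw [hAfix]
    constructor
    · rintro ⟨ξ, -, hξ⟩ ⟨x, hx, hne, hγ⟩
      exact hne ((hξ x ⟨hx, hγ⟩).trans (hξ ζ ⟨hζ, γ.2.2⟩).symm)
    · intro h
      refine ⟨ζ, ⟨hζ, γ.2.2⟩, fun x hx => ?_⟩
      by_contra hne
      exact h ⟨x, hx.1, hne, hx.2⟩
  have hcard : {g : G | (g : Ball N ≃ₜ Ball N) ζ = ζ}.Infinite ↔ Infinite Γ := by
    have : Set.range (Subgroup.inclusion hle) = {g : G | (g : Ball N ≃ₜ Ball N) ζ = ζ} := by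
      ext g
      exact ⟨fun ⟨γ, hγ⟩ => hγ ▸ γ.2.2, fun h => ⟨⟨g, g.2, h⟩, rfl⟩⟩
    rw [← this, ← Set.infinite_coe_iff]
    exact (Equiv.ofInjective _ (Subgroup.inclusion_injective hle)).infinite_iff.symm
  rw [hcard]
  constructor
  · rintro ⟨-, g, hg, hgp, hgζ⟩
    by_contra hinf
    rw [not_infinite_iff_finite] at hinf
    obtain ⟨m, hm, hpow⟩ := isOfFinOrder_iff_pow_eq_one.1
      (isOfFinOrder_of_finite (⟨g, hg, hgζ⟩ : Γ))
    exact (hpar ⟨g, hg, hgζ⟩).1 hgp ⟨_, hA.exists_fixed_of_pow_eq_one hm hpow 0⟩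
  · intro hinf
    by_contra hno
    refine not_finite_iff_infinite.2 hinf (hA.finite_of_forall_exists_fixed hAfin fun γ => ?_)
    by_contra h
    exact hno ⟨hζ, γ, γ.2.1, (hpar γ).2 h, γ.2.2⟩

/-! ### Geodesic rays in Dirichlet domains -/

/-- The point `(v, τ)` of the upper sheet of the hyperboloid `|v|² = τ² - 1` corresponds to the point
`v / (1 + τ)` of the ball. -/
theorem one_sub_normSq_hyperboloid {E : Type*} [NormedAddCommGroup E] [InnerProductSpace ℝ E]
    {v : E} {τ : ℝ} (hτ : 0 < τ) (hv : ‖v‖ ^ 2 = τ ^ 2 - 1) :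
    1 - ‖(1 / (1 + τ)) • v‖ ^ 2 = 2 / (1 + τ) := by
  rw [norm_smul, mul_pow, hv, Real.norm_of_nonneg (by positivity)]
  field_simp
  ring

/-- The hyperbolic cosine of the distance is the negative of the Lorentz product of the
corresponding points of the hyperboloid. -/
theorem cosh_hyperboloid {E : Type*} [NormedAddCommGroup E] [InnerProductSpace ℝ E]
    {v y : E} {τ : ℝ} (hτ : 0 < τ) (hv : ‖v‖ ^ 2 = τ ^ 2 - 1) (hy : 0 < 1 - ‖y‖ ^ 2) :
    1 + 2 * ‖(1 / (1 + τ)) • v - y‖ ^ 2 /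
        ((1 - ‖(1 / (1 + τ)) • v‖ ^ 2) * (1 - ‖y‖ ^ 2)) =
      (τ * (1 + ‖y‖ ^ 2) - 2 * inner ℝ v y) / (1 - ‖y‖ ^ 2) := by
  rw [one_sub_normSq_hyperboloid hτ hv, norm_sub_sq_real, norm_smul, mul_pow, hv,
    inner_smul_left, Real.norm_of_nonneg (by positivity)]
  simp only [conj_trivial]
  field_simp
  ring

/-- For a point `z₀` of hyperbolic space and a boundary point `ζ` there is a geodesic ray from `z₀`
to `ζ`, and the distance of its points from an arbitrary point `y` is given by the Poisson
kernel. The ray converges to `ζ` nontangentially. -/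
theorem exists_geodesicRay {z₀ ζ : Ball N} (hz₀ : z₀ ∈ openBall N) (hζ : ζ ∈ sphere N) :
    ∃ ρ : ℝ → Ball N, IsGeodesicRay ρ ζ ∧
      (∀ t, 0 ≤ t → ∀ y ∈ openBall N, Real.cosh (hypDist (ρ t) y) =
        Real.exp (-t) * Real.cosh (hypDist z₀ y) +
          Real.sinh t * (ballPoissonKernel z₀ ζ / ballPoissonKernel y ζ)) ∧
      ∃ C : ℝ, ∀ t, 0 ≤ t → ‖(ζ : EuclideanSpace ℝ (Fin (N + 1))) - ρ t‖ ^ 2 ≤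
        C * (1 - ‖(ρ t : EuclideanSpace ℝ (Fin (N + 1)))‖ ^ 2) ^ 2 := by
  set x := (z₀ : EuclideanSpace ℝ (Fin (N + 1))) with hx
  set z := (ζ : EuclideanSpace ℝ (Fin (N + 1))) with hz
  have hz1 : ‖z‖ = 1 := hζ
  have hq : 0 < 1 - ‖x‖ ^ 2 := one_sub_normSq_pos hz₀
  set k := ballPoissonKernel z₀ ζ with hk
  have hkpos : 0 < k := ballPoissonKernel_pos hz₀ hζ
  have hkdef : k * (1 - 2 * inner ℝ z x + ‖x‖ ^ 2) = 1 - ‖x‖ ^ 2 := by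
    have h1 : ‖z - x‖ ^ 2 = 1 - 2 * inner ℝ z x + ‖x‖ ^ 2 := by
      rw [norm_sub_sq_real, hz1, one_pow]
    have h2 : k = (1 - ‖x‖ ^ 2) / ‖z - x‖ ^ 2 := rfl
    have h3 : 0 < ‖z - x‖ ^ 2 := (div_pos_iff_of_pos_left hq).1 (h2 ▸ hkpos)
    rw [← h1, h2, div_mul_cancel₀ _ h3.ne']
  -- The geodesic `e⁻ᵗ X₀ + sinh t · Z` on the hyperboloid; `X₀` is the point corresponding to `z₀`
  -- and `Z = k (ζ, 1)` the light-like vector over `ζ` which has Lorentz product `-1` with `X₀`.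
  let τ : ℝ → ℝ := fun t =>
    Real.exp (-t) * ((1 + ‖x‖ ^ 2) / (1 - ‖x‖ ^ 2)) + Real.sinh t * k
  let v : ℝ → EuclideanSpace ℝ (Fin (N + 1)) := fun t =>
    (Real.exp (-t) * (2 / (1 - ‖x‖ ^ 2))) • x + (Real.sinh t * k) • z
  have hsinh : ∀ t, Real.exp (-t) ^ 2 + 2 * Real.exp (-t) * Real.sinh t = 1 := fun t => by
    rw [Real.sinh_eq]
    have : Real.exp (-t) * Real.exp t = 1 := by rw [← Real.exp_add]; simp
    nlinarith
  have hτ : ∀ t, 0 ≤ t → 0 < τ t := fun t ht => by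
    have := Real.sinh_nonneg_iff.2 ht
    have := Real.exp_pos (-t)
    positivity
  have hv : ∀ t, ‖v t‖ ^ 2 = τ t ^ 2 - 1 := fun t => by
    have h1 := hsinh t
    simp only [v, τ]
    rw [norm_add_sq_real, norm_smul, norm_smul, mul_pow, mul_pow, Real.norm_eq_abs,
      Real.norm_eq_abs, sq_abs, sq_abs, inner_smul_left, inner_smul_right, hz1, real_inner_comm]
    simp only [conj_trivial]
    generalize Real.exp (-t) = e at *
    generalize Real.sinh t = s at *
    generalize inner ℝ z x = i at *
    generalize ‖x‖ ^ 2 = n at *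
    field_simp
    linear_combination -(1 - n) ^ 2 * h1 - (2 * e * s) * (1 - n) * hkdef
  have hin : ∀ t, 0 ≤ t → ‖(1 / (1 + τ t)) • v t‖ < 1 := fun t ht => by
    have h1 := one_sub_normSq_hyperboloid (hτ t ht) (hv t)
    have h2 := hτ t ht
    have h3 : 0 < 2 / (1 + τ t) := by positivity
    nlinarith [norm_nonneg ((1 / (1 + τ t)) • v t)]
  classical
  let ρ : ℝ → Ball N := fun t =>
    if ht : 0 ≤ t then ⟨(1 / (1 + τ t)) • v t, mem_closedBall_zero_iff.2 (hin t ht).le⟩ else ζ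
  have hρ : ∀ t, 0 ≤ t → (ρ t : EuclideanSpace ℝ (Fin (N + 1))) = (1 / (1 + τ t)) • v t :=
    fun t ht => by simp only [ρ, dif_pos ht]
  have hρin : ∀ t, 0 ≤ t → ρ t ∈ openBall N := fun t ht => by
    rw [mem_openBall_iff, hρ t ht]; exact hin t ht
  have hρsub : ∀ t, 0 ≤ t →
      1 - ‖(ρ t : EuclideanSpace ℝ (Fin (N + 1)))‖ ^ 2 = 2 / (1 + τ t) := fun t ht => by
    rw [hρ t ht, one_sub_normSq_hyperboloid (hτ t ht) (hv t)]
  have hcosh : ∀ t, 0 ≤ t → ∀ y ∈ openBall N, Real.cosh (hypDist (ρ t) y) =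
      Real.exp (-t) * Real.cosh (hypDist z₀ y) +
        Real.sinh t * (k / ballPoissonKernel y ζ) := fun t ht y hy => by
    have hy' := one_sub_normSq_pos hy
    rw [cosh_hypDist (hρin t ht) hy, cosh_hypDist hz₀ hy, hρ t ht,
      cosh_hyperboloid (hτ t ht) (hv t) hy', ballPoissonKernel, ← hx, ← hz]
    simp only [v, τ]
    rw [inner_add_left, inner_smul_left, inner_smul_left, norm_sub_sq_real, norm_sub_sq_real, hz1]
    simp only [conj_trivial]
    field_simp
    ring
  -- The Poisson kernel grows exponentially along the ray.
  have hdist : ∀ t, 0 ≤ t → ‖z - ρ t‖ ^ 2 =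
      Real.exp (-t) / k * (1 - ‖(ρ t : EuclideanSpace ℝ (Fin (N + 1)))‖ ^ 2) := fun t ht => by
    have h1 := hρsub t ht
    have h2 : ‖(ρ t : EuclideanSpace ℝ (Fin (N + 1)))‖ ^ 2 = 1 - 2 / (1 + τ t) := by linarith
    have h3 := hτ t ht
    rw [norm_sub_sq_real, hz1, h2, hρ t ht, inner_smul_right]
    have h4 : inner ℝ z (v t) = τ t - Real.exp (-t) / k := by
      simp only [v, τ]
      rw [inner_add_right, inner_smul_right, inner_smul_right, real_inner_self_eq_norm_sq, hz1]
      field_simp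
      linear_combination (-Real.exp (-t)) * hkdef
    rw [h4]
    field_simp
    ring
  have htau : ∀ t, 0 ≤ t → 2 * Real.exp (-t) ≤
      ((1 + (1 + ‖x‖ ^ 2) / (1 - ‖x‖ ^ 2)) + k) * (2 / (1 + τ t)) := fun t ht => by
    have h1 := hτ t ht
    have h2 : Real.exp (-t) * (1 + τ t) ≤ (1 + (1 + ‖x‖ ^ 2) / (1 - ‖x‖ ^ 2)) + k := by
      have h3 : Real.exp (-t) ≤ 1 := Real.exp_le_one_iff.2 (by linarith)
      have h4 := Real.exp_pos (-t)
      have h5 := hsinh t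
      have h6 : Real.exp (-t) * Real.sinh t ≤ 1 := by nlinarith
      have h7 : Real.exp (-t) * Real.exp (-t) ≤ 1 := by nlinarith
      have h8 : 0 ≤ (1 + ‖x‖ ^ 2) / (1 - ‖x‖ ^ 2) := by positivity
      simp only [τ]
      nlinarith [mul_le_mul_of_nonneg_right h7 h8, mul_le_mul_of_nonneg_right h6 hkpos.le]
    rw [mul_div_assoc', le_div_iff₀ (by positivity)]
    linarith
  refine ⟨ρ, ⟨hζ, hρin, fun t u ht hu => ?_, ?_⟩, hcosh,
    ((1 + (1 + ‖x‖ ^ 2) / (1 - ‖x‖ ^ 2)) + k) / (2 * k), fun t ht => ?_⟩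
  · have h0 := hypDist_nonneg (hρin t ht) (hρin u hu)
    have hsymm : Real.cosh (hypDist z₀ (ρ u)) = Real.cosh (hypDist (ρ u) z₀) := by
      rw [hypDist, hypDist, norm_sub_rev, mul_comm (1 - _)]
    have hker : ballPoissonKernel (ρ u) ζ = k * Real.exp u := by
      unfold ballPoissonKernel
      rw [hdist u hu, Real.exp_neg]
      have := one_sub_normSq_pos (hρin u hu)
      field_simp
    have h1 := hcosh t ht _ (hρin u hu)
    rw [hsymm, hcosh u hu _ hz₀, hypDist_self, Real.cosh_zero, ← hk, div_self hkpos.ne', hker,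
      div_mul_cancel_left₀ hkpos.ne', ← Real.exp_neg] at h1
    have h2 : Real.cosh (hypDist (ρ t) (ρ u)) = Real.cosh |t - u| := by
      rw [h1, Real.cosh_abs, Real.cosh_eq, Real.sinh_eq, Real.sinh_eq]
      have e1 : Real.exp (t - u) = Real.exp t * Real.exp (-u) := by rw [← Real.exp_add]; ring_nf
      have e2 : Real.exp (-(t - u)) = Real.exp (-t) * Real.exp u := by
        rw [← Real.exp_add]; ring_nf
      rw [e1, e2]
      ring
    exact (Real.cosh_strictMonoOn.injOn.eq_iff h0 (Set.mem_Ici.2 (abs_nonneg _))).1 h2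
  · rw [tendsto_subtype_rng, tendsto_iff_norm_sub_tendsto_zero]
    have h1 : Tendsto (fun t : ℝ => Real.exp (-t) / k) atTop (𝓝 0) := by
      simpa using (Real.tendsto_exp_neg_atTop_nhds_zero).div_const k
    have h2 : Tendsto (fun t => ‖(ρ t : EuclideanSpace ℝ (Fin (N + 1))) - z‖ ^ 2) atTop (𝓝 0) := by
      refine squeeze_zero' (Eventually.of_forall fun t => by positivity) ?_ h1
      filter_upwards [eventually_ge_atTop 0] with t ht
      rw [norm_sub_rev, hdist t ht]
      exact mul_le_of_le_one_right (by positivity) (by nlinarith [sq_nonneg ‖(ρ t).1‖])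
    simpa [Real.sqrt_sq (norm_nonneg _)] using h2.sqrt
  · rw [hdist t ht, hρsub t ht]
    have h1 := htau t ht
    have h2 : 0 < 2 / (1 + τ t) := by have := hτ t ht; positivity
    have h3 : Real.exp (-t) / k ≤
        ((1 + (1 + ‖x‖ ^ 2) / (1 - ‖x‖ ^ 2)) + k) / (2 * k) * (2 / (1 + τ t)) := by
      rw [div_mul_eq_mul_div, div_le_div_iff₀ hkpos (by positivity)]
      nlinarith
    rw [sq (2 / _), ← mul_assoc]
    exact mul_le_mul_of_nonneg_right h3 h2.le

/-- The ray from the centre `z₀` of a Dirichlet domain to `ζ` lies in the domain if no point of the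
orbit of `z₀` lies in the open horoball at `ζ` with `z₀` on its boundary. -/
theorem mem_dirichletDomain_of_cosh {G : Subgroup (Ball N ≃ₜ Ball N)}
    (hG : ∀ g ∈ G, IsConformal g) {z₀ ζ : Ball N} (hz₀ : IsDirichletCentre G z₀)
    (hζ : ζ ∈ sphere N)
    (hmax : ∀ g ∈ G, ballPoissonKernel (g z₀) ζ ≤ ballPoissonKernel z₀ ζ) {t : ℝ} (ht : 0 ≤ t)
    {x : Ball N} (hx : x ∈ openBall N)
    (hcosh : ∀ y ∈ openBall N, Real.cosh (hypDist x y) =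
        Real.exp (-t) * Real.cosh (hypDist z₀ y) +
          Real.sinh t * (ballPoissonKernel z₀ ζ / ballPoissonKernel y ζ)) :
    x ∈ dirichletDomain G z₀ := by
  refine ⟨hx, fun g hg hg1 => ?_⟩
  have hgz := ((hG g hg).map_openBall z₀).2 hz₀.1
  have hk := ballPoissonKernel_pos hz₀.1 hζ
  have hkg := ballPoissonKernel_pos hgz hζ
  have hlt : 1 < Real.cosh (hypDist z₀ (g z₀)) := by
    rw [cosh_hypDist hz₀.1 hgz, lt_add_iff_pos_right]
    have := one_sub_normSq_pos hz₀.1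
    have := one_sub_normSq_pos hgz
    have : 0 < ‖(z₀ : EuclideanSpace ℝ (Fin (N + 1))) - g z₀‖ :=
      norm_pos_iff.2 fun h => hg1 (hz₀.2 g hg (Subtype.ext (sub_eq_zero.1 h)).symm)
    positivity
  refine (Real.cosh_strictMonoOn.lt_iff_lt (hypDist_nonneg hx hz₀.1)
    (hypDist_nonneg hx hgz)).1 ?_
  rw [hcosh _ hz₀.1, hcosh _ hgz, hypDist_self, Real.cosh_zero, div_self hk.ne']
  refine add_lt_add_of_lt_of_le (mul_lt_mul_of_pos_left hlt (Real.exp_pos _))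
    (mul_le_mul_of_nonneg_left ?_ (Real.sinh_nonneg_iff.2 ht))
  rw [one_le_div hkg]
  exact hmax g hg

/-- Conformal derivatives at a point converging nontangentially to `ζ` are controlled by the
derivative at `ζ`, uniformly over all conformal maps. -/
theorem conformalDeriv_le_of_nontangential {g : Ball N ≃ₜ Ball N} (hg : IsConformal g)
    {z ζ : Ball N} (hζ : ζ ∈ sphere N) {C : ℝ}
    (hC : ‖(ζ : EuclideanSpace ℝ (Fin (N + 1))) - z‖ ^ 2 ≤
        C * (1 - ‖(z : EuclideanSpace ℝ (Fin (N + 1)))‖ ^ 2) ^ 2) :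
    conformalDeriv g z ≤ (2 + 8 * |C|) * conformalDeriv g ζ := by
  unfold conformalDeriv
  have ha := hg.symm_origin_mem
  have hq := one_sub_normSq_pos ha
  have hdz := denom_pos (norm_le_one z) ha
  have hdζ := denom_pos (norm_le_one ζ) ha
  have hsq := sq_one_sub_norm_le_denom (norm_le_one z) (le_of_lt ha)
  have hzn := norm_le_one z
  have hz0 := norm_nonneg (z : EuclideanSpace ℝ (Fin (N + 1)))
  rw [mul_div_assoc', div_le_div_iff₀ hdz hdζ]
  rw [denom_eq (ζ : EuclideanSpace ℝ (Fin (N + 1))), mem_sphere_iff.1 hζ] at *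
  set a := (g.symm (origin N) : EuclideanSpace ℝ (Fin (N + 1)))
  have hza : ‖(z : EuclideanSpace ℝ (Fin (N + 1))) - a‖ ^ 2 ≤
      1 - 2 * inner ℝ (z : EuclideanSpace ℝ (Fin (N + 1))) a +
        ‖(z : EuclideanSpace ℝ (Fin (N + 1)))‖ ^ 2 * ‖a‖ ^ 2 := by
    rw [denom_eq]
    have : 0 ≤ (1 - ‖(z : EuclideanSpace ℝ (Fin (N + 1)))‖ ^ 2) * (1 - ‖a‖ ^ 2) :=
      mul_nonneg (by nlinarith) hq.le
    linarith
  set D := 1 - 2 * inner ℝ (z : EuclideanSpace ℝ (Fin (N + 1))) a +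
        ‖(z : EuclideanSpace ℝ (Fin (N + 1)))‖ ^ 2 * ‖a‖ ^ 2
  have h1 : ‖(ζ : EuclideanSpace ℝ (Fin (N + 1))) - z‖ ^ 2 ≤ 4 * |C| * D := by
    have h2 : (1 - ‖(z : EuclideanSpace ℝ (Fin (N + 1)))‖ ^ 2) ^ 2 ≤ 4 * D := by
      have : (1 - ‖(z : EuclideanSpace ℝ (Fin (N + 1)))‖ ^ 2) ^ 2 =
        (1 - ‖(z : EuclideanSpace ℝ (Fin (N + 1)))‖) ^ 2 *
          (1 + ‖(z : EuclideanSpace ℝ (Fin (N + 1)))‖) ^ 2 := by ring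
      rw [this]
      have : (1 + ‖(z : EuclideanSpace ℝ (Fin (N + 1)))‖) ^ 2 ≤ 4 := by nlinarith
      nlinarith [sq_nonneg (1 - ‖(z : EuclideanSpace ℝ (Fin (N + 1)))‖)]
    calc _ ≤ C * (1 - ‖(z : EuclideanSpace ℝ (Fin (N + 1)))‖ ^ 2) ^ 2 := hC
      _ ≤ |C| * (4 * D) := mul_le_mul (le_abs_self C) h2 (sq_nonneg _) (abs_nonneg C)
      _ = _ := by ring
  have h2 : ‖(ζ : EuclideanSpace ℝ (Fin (N + 1))) - a‖ ^ 2 ≤ (2 + 8 * |C|) * D := by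
    have h3 := norm_sub_le_norm_sub_add_norm_sub (ζ : EuclideanSpace ℝ (Fin (N + 1))) z a
    nlinarith [norm_nonneg ((ζ : EuclideanSpace ℝ (Fin (N + 1))) - a),
      sq_nonneg (‖(ζ : EuclideanSpace ℝ (Fin (N + 1))) - z‖ -
        ‖(z : EuclideanSpace ℝ (Fin (N + 1))) - a‖)]
  nlinarith

/-! ### Orbits and limit sets -/

section Discrete

variable {G : Subgroup (Ball N ≃ₜ Ball N)} {s : ℝ}

theorem finite_setOf_le_conformalDeriv {x : Ball N} (hs : 0 < s)
    (hP : poincareSeries G x s < ∞) {r : ℝ} (hr : 0 < r) :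
    {g : G | r ≤ conformalDeriv (g : Ball N ≃ₜ Ball N) x}.Finite := by
  have hpos : ENNReal.ofReal (r ^ s) ≠ 0 :=
    (ENNReal.ofReal_pos.2 (Real.rpow_pos_of_pos hr s)).ne'
  refine (ENNReal.finite_const_le_of_tsum_ne_top hP.ne hpos).subset fun g hg => ?_
  exact ENNReal.ofReal_le_ofReal (Real.rpow_le_rpow hr.le hg hs.le)

theorem countable_of_poincareSeries_lt_top (hG : ∀ g ∈ G, IsConformal g) {x : Ball N}
    (hP : poincareSeries G x s < ∞) : Countable G := by
  have h := Summable.countable_support_ennreal hP.ne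
  have huniv : (Function.support fun g : G =>
      ENNReal.ofReal (conformalDeriv (g : Ball N ≃ₜ Ball N) x ^ s)) = Set.univ := by
    refine Set.eq_univ_of_forall fun g => ?_
    exact (ENNReal.ofReal_pos.2 (Real.rpow_pos_of_pos
      ((hG g g.2).conformalDeriv_pos x) s)).ne'
  rwa [huniv, Set.countable_univ_iff] at h

theorem limitSet_eq_empty_of_finite [Finite G] : limitSet G = ∅ := by
  have hfin : (orbit G (origin N)).Finite := by
    refine (Set.finite_range fun g : G => (g : Ball N ≃ₜ Ball N) (origin N)).subset ?_
    rintro _ ⟨g, hg, rfl⟩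
    exact ⟨⟨g, hg⟩, rfl⟩
  rw [limitSet, hfin.isClosed.closure_eq, Set.sdiff_self]

/-- For a nonpositive exponent, convergence of the Poincaré series means finiteness of `G`. -/
theorem finite_of_nonpos (hG : ∀ g ∈ G, IsConformal g) (hs : s ≤ 0)
    (hP : poincareSeries G (origin N) s < ∞) : Finite G := by
  have h := ENNReal.finite_const_le_of_tsum_ne_top hP.ne one_ne_zero
  refine Set.finite_univ_iff.1 (h.subset fun g _ => ?_)
  change 1 ≤ ENNReal.ofReal _
  rw [ENNReal.one_le_ofReal]
  refine Real.one_le_rpow_of_pos_of_le_one_of_nonpos ((hG g g.2).conformalDeriv_pos _) ?_ hs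
  rw [conformalDeriv_origin]
  nlinarith [sq_nonneg ‖((g : Ball N ≃ₜ Ball N).symm (origin N)).1‖]

theorem map_mem_limitSet {g : Ball N ≃ₜ Ball N} (hg : g ∈ G) {ζ : Ball N} (hζ : ζ ∈ limitSet G) :
    g ζ ∈ limitSet G := by
  refine ⟨map_mem_closure g.continuous hζ.1 ?_, ?_⟩
  · rintro _ ⟨h, hh, rfl⟩
    exact ⟨g * h, G.mul_mem hg hh, rfl⟩
  · rintro ⟨h, hh, heq⟩
    refine hζ.2 ⟨g⁻¹ * h, G.mul_mem (G.inv_mem hg) hh, ?_⟩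
    change g.symm (h (origin N)) = ζ
    rw [heq, g.symm_apply_apply]

theorem finite_setOf_le_one_sub_normSq
    (hfin : ∀ r : ℝ, 0 < r → {g : G | r ≤ conformalDeriv (g : Ball N ≃ₜ Ball N) (origin N)}.Finite)
    {r : ℝ} (hr : 0 < r) :
    {x | x ∈ orbit G (origin N) ∧ r ≤ 1 - ‖(x : EuclideanSpace ℝ (Fin (N + 1)))‖ ^ 2}.Finite := by
  refine ((hfin r hr).image fun g : G => (g : Ball N ≃ₜ Ball N).symm (origin N)).subset ?_
  rintro _ ⟨⟨g, hg, rfl⟩, hr'⟩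
  refine ⟨⟨g⁻¹, G.inv_mem hg⟩, ?_, rfl⟩
  change _ ≤ conformalDeriv _ _
  rw [conformalDeriv_origin]
  exact hr'

theorem infinite_of_accPt {X : Type*} [TopologicalSpace X] [T1Space X] {x : X} {C : Set X}
    (h : AccPt x (𝓟 C)) : C.Infinite := fun hfin => by
  rw [accPt_principal_iff_clusterPt, ← mem_closure_iff_clusterPt,
    (hfin.subset Set.sdiff_subset).isClosed.closure_eq] at h
  exact h.2 rfl

/-- Accumulation points of the orbit of the origin lie on the sphere. -/
theorem mem_sphere_of_accPt
    (hfin : ∀ r : ℝ, 0 < r → {g : G | r ≤ conformalDeriv (g : Ball N ≃ₜ Ball N) (origin N)}.Finite)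
    {ζ : Ball N} (hζ : AccPt ζ (𝓟 (orbit G (origin N)))) : ζ ∈ sphere N := by
  by_contra hne
  have hlt : ‖(ζ : EuclideanSpace ℝ (Fin (N + 1)))‖ < 1 := lt_of_le_of_ne (norm_le_one ζ) hne
  have hr := one_sub_normSq_pos (x := ζ) hlt
  have hS := finite_setOf_le_one_sub_normSq hfin (half_pos hr)
  have hU : {x : Ball N | (1 - ‖(ζ : EuclideanSpace ℝ (Fin (N + 1)))‖ ^ 2) / 2 <
      1 - ‖(x : EuclideanSpace ℝ (Fin (N + 1)))‖ ^ 2} ∈ 𝓝 ζ := by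
    refine (isOpen_lt continuous_const (by fun_prop)).mem_nhds ?_
    exact half_lt_self hr
  exact infinite_of_accPt (hζ.nhds_inter hU) (hS.subset fun x hx => ⟨hx.2, le_of_lt hx.1⟩)

theorem accPt_of_mem_limitSet {ζ : Ball N} (hζ : ζ ∈ limitSet G) :
    AccPt ζ (𝓟 (orbit G (origin N))) := by
  rw [accPt_principal_iff_clusterPt, Set.sdiff_singleton_eq_self hζ.2]
  exact mem_closure_iff_clusterPt.1 hζ.1

/-- A limit point outside the big horospherical limit set has only finitely many conformal
derivatives above any given positive bound. -/
theorem finite_setOf_lt_conformalDeriv_of_notMem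
    (hfin : ∀ r : ℝ, 0 < r → {g : G | r ≤ conformalDeriv (g : Ball N ≃ₜ Ball N) (origin N)}.Finite)
    (hG : ∀ g ∈ G, IsConformal g) {ζ : Ball N} (hζ : ζ ∈ limitSet G)
    (hH : ζ ∉ bigHorosphericalLimitSet G) {c : ℝ} (hc : 0 < c) :
    {g : G | c < conformalDeriv (g : Ball N ≃ₜ Ball N) ζ}.Finite := by
  have hζs := mem_sphere_of_accPt hfin (accPt_of_mem_limitSet hζ)
  by_contra hinf
  change Set.Infinite _ at hinf
  set T := (fun g : G => (g : Ball N ≃ₜ Ball N).symm (origin N)) ''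
    {g : G | c < conformalDeriv (g : Ball N ≃ₜ Ball N) ζ} with hT
  have hTsub : T ⊆ orbit G (origin N) ∩ horoball ζ c := by
    rintro _ ⟨g, hg, rfl⟩
    refine ⟨⟨(g : Ball N ≃ₜ Ball N)⁻¹, G.inv_mem g.2, rfl⟩, (hG g g.2).symm_origin_mem, ?_⟩
    rw [← conformalDeriv_eq_ballPoissonKernel _ hζs]
    exact hg
  have hTinf : T.Infinite := by
    -- Only finitely many elements move a given point to the origin.
    intro hTfin
    refine hinf (Set.Finite.of_finite_fibers _ hTfin ?_)
    rintro x ⟨g, hg, rfl⟩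
    refine (hfin _ ((hG g g.2).conformalDeriv_pos (origin N))).subset ?_
    rintro h ⟨-, hh⟩
    change conformalDeriv _ _ ≤ conformalDeriv _ _
    rw [conformalDeriv_origin, conformalDeriv_origin]
    exact (by rw [show (h : Ball N ≃ₜ Ball N).symm (origin N) = _ from hh])
  obtain ⟨x, hx⟩ := hTinf.exists_accPt_principal
  have hxs := mem_sphere_of_accPt hfin (hx.mono (Filter.principal_mono.2
    (hTsub.trans Set.inter_subset_left)))
  have hxζ : x = ζ := by
    have hcl : IsClosed {y : Ball N | c * ‖(ζ : EuclideanSpace ℝ (Fin (N + 1))) - y‖ ^ 2 ≤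
        1 - ‖(y : EuclideanSpace ℝ (Fin (N + 1)))‖ ^ 2} :=
      isClosed_le (by fun_prop) (by fun_prop)
    have hsub : T ⊆ {y : Ball N | c * ‖(ζ : EuclideanSpace ℝ (Fin (N + 1))) - y‖ ^ 2 ≤
        1 - ‖(y : EuclideanSpace ℝ (Fin (N + 1)))‖ ^ 2} := by
      intro y hy
      have hy' := (hTsub hy).2
      have h1 := one_sub_normSq_pos hy'.1
      have h2 : c < (1 - ‖(y : EuclideanSpace ℝ (Fin (N + 1)))‖ ^ 2) /
        ‖(ζ : EuclideanSpace ℝ (Fin (N + 1))) - y‖ ^ 2 := hy'.2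
      have h3 := (div_pos_iff_of_pos_left h1).1 (hc.trans h2)
      exact ((lt_div_iff₀ h3).1 h2).le
    have hmem := closure_minimal hsub hcl (mem_closure_iff_clusterPt.2 hx.clusterPt)
    rw [Set.mem_ofPred_eq, mem_sphere_iff.1 hxs] at hmem
    have h0 : ‖(ζ : EuclideanSpace ℝ (Fin (N + 1))) - x‖ ^ 2 ≤ 0 := by
      by_contra h
      nlinarith
    have := pow_eq_zero_iff two_ne_zero |>.1 (le_antisymm h0 (sq_nonneg _))
    exact Subtype.ext (sub_eq_zero.1 (norm_eq_zero.1 this)).symm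
  exact hH ⟨hζ, c, hc, (hxζ ▸ hx).mono (Filter.principal_mono.2 hTsub)⟩

theorem infinite_setOf_lt_conformalDeriv_of_mem {ζ : Ball N} (hζs : ζ ∈ sphere N)
    (hH : ζ ∈ bigHorosphericalLimitSet G) :
    ∃ c : ℝ, 0 < c ∧ {g : G | c < conformalDeriv (g : Ball N ≃ₜ Ball N) ζ}.Infinite := by
  obtain ⟨-, c, hc, hacc⟩ := hH
  refine ⟨c, hc, fun hfin => ?_⟩
  refine infinite_of_accPt hacc ((hfin.image
    fun g : G => (g : Ball N ≃ₜ Ball N).symm (origin N)).subset ?_)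
  rintro _ ⟨⟨g, hg, rfl⟩, hx⟩
  refine ⟨⟨g⁻¹, G.inv_mem hg⟩, ?_, rfl⟩
  change c < conformalDeriv _ _
  rw [conformalDeriv_eq_ballPoissonKernel _ hζs]
  exact hx.2

/-- A positive function with finite superlevel sets attains its maximum, and only finitely often. -/
theorem exists_forall_le_of_finite_superlevel {ι : Type*} [Nonempty ι] (f : ι → ℝ)
    (hpos : ∀ i, 0 < f i) (hfin : ∀ c : ℝ, 0 < c → {i | c < f i}.Finite) :
    (∃ i, ∀ k, f k ≤ f i) ∧ ∀ i, {k | f i ≤ f k}.Finite := by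
  obtain ⟨i₀⟩ := ‹Nonempty ι›
  have h : ∀ i, {k | f i ≤ f k}.Finite := fun i =>
    (hfin _ (half_pos (hpos i))).subset fun k hk => (half_lt_self (hpos i)).trans_le hk
  obtain ⟨i, hi, hmax⟩ := Set.exists_max_image _ f (h i₀) ⟨i₀, le_refl (f i₀)⟩
  exact ⟨⟨i, fun k => (le_total (f i₀) (f k)).elim (hmax k) fun hk => hk.trans hi⟩, h⟩

end Discrete

/-! ### Conformality of ending measures -/

section Measure

variable {G : Subgroup (Ball N ≃ₜ Ball N)} {s : ℝ}

/-- A measure is `s`-conformal for `G` if each `g ∈ G` transforms it with the density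
`j(g, ·)^s`; the inverse of `g` is used here to have the density of `g`. -/
def IsConformalMeasure (G : Subgroup (Ball N ≃ₜ Ball N)) (s : ℝ) (μ : Measure (Ball N)) : Prop :=
  ∀ g ∈ G, μ.map (g.symm : Ball N → Ball N) =
    μ.withDensity fun z => ENNReal.ofReal (conformalDeriv g z ^ s)

theorem poincareSeries_eq_mul (hG : ∀ g ∈ G, IsConformal g) {g : Ball N ≃ₜ Ball N} (hg : g ∈ G)
    (z : Ball N) : poincareSeries G z s =
      ENNReal.ofReal (conformalDeriv g z ^ s) * poincareSeries G (g z) s := by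
  unfold poincareSeries
  rw [← (Equiv.mulRight (⟨g, hg⟩ : G)).tsum_eq, ← ENNReal.tsum_mul_left]
  refine tsum_congr fun h => ?_
  have h1 : (((Equiv.mulRight (⟨g, hg⟩ : G)) h : G) : Ball N ≃ₜ Ball N) = h * g := rfl
  have hj := (hG g hg).conformalDeriv_pos z
  rw [h1, (hG h h.2).conformalDeriv_mul (hG g hg) (hG _ (G.mul_mem h.2 hg)), mul_comm,
    Real.mul_rpow hj.le ((hG h h.2).conformalDeriv_pos (g z)).le,
    ENNReal.ofReal_mul (Real.rpow_pos_of_pos hj s).le]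

theorem lintegral_orbitMeasure (G : Subgroup (Ball N ≃ₜ Ball N)) (s : ℝ) (z : Ball N)
    {f : Ball N → ℝ≥0∞} (hf : Measurable f) :
    ∫⁻ x, f x ∂(orbitMeasure G s z) = (poincareSeries G z s)⁻¹ *
      ∑' g : G, ENNReal.ofReal (conformalDeriv (g : Ball N ≃ₜ Ball N) z ^ s) *
        f ((g : Ball N ≃ₜ Ball N) z) := by
  rw [orbitMeasure, lintegral_smul_measure, lintegral_sum_measure]
  simp only [lintegral_smul_measure, lintegral_dirac' _ hf, smul_eq_mul]

theorem continuous_conformalDeriv_rpow {g : Ball N ≃ₜ Ball N} (hg : IsConformal g) :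
    Continuous fun z => conformalDeriv g z ^ s :=
  hg.continuous_conformalDeriv.rpow_const fun z => Or.inl (hg.conformalDeriv_pos z).ne'

theorem measurable_ofReal_conformalDeriv_rpow {g : Ball N ≃ₜ Ball N} (hg : IsConformal g) :
    Measurable fun z => ENNReal.ofReal (conformalDeriv g z ^ s) :=
  ENNReal.measurable_ofReal.comp (continuous_conformalDeriv_rpow hg).measurable

/-- The orbit measures are conformal, by the chain rule. -/
theorem lintegral_comp_symm_orbitMeasure (hG : ∀ g ∈ G, IsConformal g) {g : Ball N ≃ₜ Ball N}
    (hg : g ∈ G) (z : Ball N) {f : Ball N → ℝ≥0∞} (hf : Measurable f) :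
    ∫⁻ x, f (g.symm x) ∂(orbitMeasure G s z) =
      ∫⁻ x, ENNReal.ofReal (conformalDeriv g x ^ s) * f x ∂(orbitMeasure G s z) := by
  rw [lintegral_orbitMeasure G s z (f := fun x => f (g.symm x))
      (hf.comp g.symm.continuous.measurable),
    lintegral_orbitMeasure G s z (f := fun x => ENNReal.ofReal (conformalDeriv g x ^ s) * f x)
      ((measurable_ofReal_conformalDeriv_rpow (hG g hg)).mul hf)]
  congr 1
  rw [← (Equiv.mulLeft (⟨g, hg⟩ : G)).tsum_eq]
  refine tsum_congr fun h => ?_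
  have h1 : (((Equiv.mulLeft (⟨g, hg⟩ : G)) h : G) : Ball N ≃ₜ Ball N) = g * h := rfl
  have h2 : g.symm ((g * (h : Ball N ≃ₜ Ball N)) z) = (h : Ball N ≃ₜ Ball N) z :=
    g.symm_apply_apply _
  have hj := (hG g hg).conformalDeriv_pos ((h : Ball N ≃ₜ Ball N) z)
  rw [h1, h2, (hG g hg).conformalDeriv_mul (hG h h.2) (hG _ (G.mul_mem hg h.2)),
    Real.mul_rpow hj.le ((hG h h.2).conformalDeriv_pos z).le,
    ENNReal.ofReal_mul (Real.rpow_pos_of_pos hj s).le,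
    mul_comm (ENNReal.ofReal (conformalDeriv g _ ^ s)), mul_assoc]

theorem IsEndingMeasure.isConformalMeasure (hG : ∀ g ∈ G, IsConformal g)
    {μ : ProbabilityMeasure (Ball N)} (hμ : IsEndingMeasure G s μ) :
    IsConformalMeasure G s (μ : Measure (Ball N)) := by
  obtain ⟨-, z₀, ζ, z, -, -, φ, -, ν, hν, hlim⟩ := hμ
  rw [ProbabilityMeasure.tendsto_iff_forall_lintegral_tendsto] at hlim
  intro g hg
  have hd := measurable_ofReal_conformalDeriv_rpow (s := s) (hG g hg)
  have hgm := g.symm.continuous.measurable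
  have : IsFiniteMeasure (μ.toMeasure.map (g.symm : Ball N → Ball N)) :=
    Measure.isFiniteMeasure_map _ _
  refine ext_of_forall_lintegral_eq_of_IsFiniteMeasure fun f => ?_
  have hf : Measurable fun x => (f x : ℝ≥0∞) := f.continuous.measurable.coe_nnreal_ennreal
  rw [lintegral_map hf hgm, lintegral_withDensity_eq_lintegral_mul _ hd hf]
  -- Both sides are limits of the corresponding integrals for the approximating measures.
  let f₁ : BoundedContinuousFunction (Ball N) NNReal :=
    BoundedContinuousFunction.mkOfCompact ⟨fun x => f (g.symm x), by fun_prop⟩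
  let f₂ : BoundedContinuousFunction (Ball N) NNReal :=
    BoundedContinuousFunction.mkOfCompact
      ⟨fun x => (conformalDeriv g x ^ s).toNNReal * f x,
        (continuous_real_toNNReal.comp (continuous_conformalDeriv_rpow (hG g hg))).mul
          f.continuous⟩
  have h₁ := hlim f₁
  have h₂ := hlim f₂
  have heq : (fun n => ∫⁻ x, (f₁ x : ℝ≥0∞) ∂(ν n : Measure (Ball N))) =
      fun n => ∫⁻ x, (f₂ x : ℝ≥0∞) ∂(ν n : Measure (Ball N)) := by
    funext n
    rw [hν]
    refine (lintegral_comp_symm_orbitMeasure hG hg (z (φ n)) hf).trans ?_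
    refine lintegral_congr fun x => ?_
    exact (ENNReal.coe_mul _ _).symm
  rw [heq] at h₁
  refine (tendsto_nhds_unique h₁ h₂).trans (lintegral_congr fun x => ?_)
  exact ENNReal.coe_mul _ _

namespace IsConformalMeasure

variable {μ : Measure (Ball N)}

theorem lintegral_comp (hG : ∀ g ∈ G, IsConformal g) (hμ : IsConformalMeasure G s μ)
    {g : Ball N ≃ₜ Ball N} (hg : g ∈ G) {f : Ball N → ℝ≥0∞} (hf : Measurable f) :
    ∫⁻ x, f (g.symm x) ∂μ = ∫⁻ x, ENNReal.ofReal (conformalDeriv g x ^ s) * f x ∂μ := by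
  rw [← lintegral_map hf g.symm.continuous.measurable, hμ g hg,
    lintegral_withDensity_eq_lintegral_mul _
      (measurable_ofReal_conformalDeriv_rpow (hG g hg)) hf]
  rfl

theorem measure_singleton (hμ : IsConformalMeasure G s μ)
    {g : Ball N ≃ₜ Ball N} (hg : g ∈ G) (ζ : Ball N) :
    μ {g ζ} = ENNReal.ofReal (conformalDeriv g ζ ^ s) * μ {ζ} := by
  have h := congrArg (fun m : Measure (Ball N) => m {ζ}) (hμ g hg)
  rw [Measure.map_apply g.symm.continuous.measurable (measurableSet_singleton ζ),
    withDensity_apply _ (measurableSet_singleton ζ), lintegral_singleton] at h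
  rw [← h]
  congr 1
  ext x
  simp [g.symm_apply_eq]

/-- Elements of `G` fixing an atom have derivative one there. -/
theorem conformalDeriv_eq_one_of_fixes [IsFiniteMeasure μ] (hG : ∀ g ∈ G, IsConformal g)
    (hμ : IsConformalMeasure G s μ) (hs : s ≠ 0) {ζ : Ball N} (hζ : μ {ζ} ≠ 0)
    {g : Ball N ≃ₜ Ball N} (hg : g ∈ G) (hgζ : g ζ = ζ) : conformalDeriv g ζ = 1 := by
  have h := hμ.measure_singleton hg ζ
  rw [hgζ] at h
  have h1 : ENNReal.ofReal (conformalDeriv g ζ ^ s) = 1 := by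
    have h2 : 1 * μ {ζ} = ENNReal.ofReal (conformalDeriv g ζ ^ s) * μ {ζ} := by rwa [one_mul]
    exact ((ENNReal.mul_left_inj hζ (measure_ne_top _ _)).1 h2).symm
  rw [ENNReal.ofReal_eq_one] at h1
  rw [← Real.one_rpow s] at h1
  exact (Real.rpow_left_inj ((hG g hg).conformalDeriv_pos ζ).le zero_le_one hs).1 h1

/-- If infinitely many derivatives of elements of `G` at an atom are bounded away from zero, then
the atom has infinite stabilizer: the translates of the atom by these elements are atoms of
mass bounded below, so that there are only finitely many of them. -/
theorem infinite_stabilizer [IsFiniteMeasure μ]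
    (hμ : IsConformalMeasure G s μ) (hs : 0 < s) {ζ : Ball N} (hζ : μ {ζ} ≠ 0) {c : ℝ}
    (hc : 0 < c) (hinf : {g : G | c < conformalDeriv (g : Ball N ≃ₜ Ball N) ζ}.Infinite) :
    {g : G | (g : Ball N ≃ₜ Ball N) ζ = ζ}.Infinite := by
  intro hfin
  refine hinf (Set.Finite.of_finite_fibers (fun g : G => (g : Ball N ≃ₜ Ball N) ζ) ?_ ?_)
  · have hpos : ENNReal.ofReal (c ^ s) * μ {ζ} ≠ 0 :=
      mul_ne_zero (ENNReal.ofReal_pos.2 (Real.rpow_pos_of_pos hc s)).ne' hζ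
    refine (Measure.finite_const_le_meas_of_disjoint_iUnion μ (pos_iff_ne_zero.2 hpos)
      (As := fun x : Ball N => {x}) (fun x => measurableSet_singleton x)
      (fun x y hxy => Set.disjoint_singleton.2 hxy) (measure_ne_top _ _)).subset ?_
    rintro _ ⟨g, hg, rfl⟩
    change _ ≤ μ {(g : Ball N ≃ₜ Ball N) ζ}
    rw [hμ.measure_singleton g.2]
    gcongr
    exact le_of_lt hg
  · rintro _ ⟨g, -, rfl⟩
    refine (hfin.image fun h => g * h).subset ?_
    rintro h ⟨-, hh⟩
    refine ⟨g⁻¹ * h, ?_, mul_inv_cancel_left g h⟩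
    change (g : Ball N ≃ₜ Ball N).symm ((h : Ball N ≃ₜ Ball N) ζ) = ζ
    rw [show (h : Ball N ≃ₜ Ball N) ζ = (g : Ball N ≃ₜ Ball N) ζ from hh]
    exact Homeomorph.symm_apply_apply _ _

/-- Almost everywhere where the derivatives of the elements of `G` tend to zero, the Poincaré
series converges. On this set the elements maximizing the derivative form a nonempty finite set,
and the points at which the identity is maximizing form a fundamental set for `G`, apart from
finite multiplicities. Summing the masses of its translates shows that the Poincaré series is
integrable over it, after division by these multiplicities. -/
theorem ae_poincareSeries_lt_top [IsFiniteMeasure μ] [Countable G]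
    (hG : ∀ g ∈ G, IsConformal g) (hμ : IsConformalMeasure G s μ) :
    ∀ᵐ ζ ∂μ, (∀ c : ℝ, 0 < c → {g : G | c < conformalDeriv (g : Ball N ≃ₜ Ball N) ζ}.Finite) →
      poincareSeries G ζ s < ∞ := by
  have hjmul : ∀ (g h : G) (x : Ball N), conformalDeriv ((g * h : G) : Ball N ≃ₜ Ball N) x =
      conformalDeriv (g : Ball N ≃ₜ Ball N) ((h : Ball N ≃ₜ Ball N) x) *
        conformalDeriv (h : Ball N ≃ₜ Ball N) x := fun g h x =>
    (hG g g.2).conformalDeriv_mul (hG h h.2) (hG _ (g * h).2) x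
  have hjpos : ∀ (g : G) (x : Ball N), 0 < conformalDeriv (g : Ball N ≃ₜ Ball N) x :=
    fun g x => (hG g g.2).conformalDeriv_pos x
  -- `M g` is the set of points at which `g` is maximizing, and `n` the number of such elements.
  let M : G → Set (Ball N) := fun g => {x | ∀ h : G, conformalDeriv (h : Ball N ≃ₜ Ball N) x ≤
    conformalDeriv (g : Ball N ≃ₜ Ball N) x}
  have hM : ∀ g, MeasurableSet (M g) := fun g => by
    have : M g = ⋂ h : G, {x | conformalDeriv (h : Ball N ≃ₜ Ball N) x ≤
        conformalDeriv (g : Ball N ≃ₜ Ball N) x} := by ext; simp [M]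
    rw [this]
    exact MeasurableSet.iInter fun h => (isClosed_le (hG h h.2).continuous_conformalDeriv
      (hG g g.2).continuous_conformalDeriv).measurableSet
  have hMmul : ∀ (g h : G) (x : Ball N), (h : Ball N ≃ₜ Ball N) x ∈ M g ↔ x ∈ M (g * h) := by
    intro g h x
    constructor
    · intro hx k
      have := hx (k * h⁻¹)
      have h1 := hjmul (k * h⁻¹) h x
      rw [inv_mul_cancel_right] at h1
      have h2 := hjmul g h x
      rw [h1, h2]
      exact mul_le_mul_of_nonneg_right this (hjpos h x).le
    · intro hx k
      have := hx (k * h)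
      rw [hjmul, hjmul] at this
      exact le_of_mul_le_mul_right this (hjpos h x)
  have hind : ∀ (g h : G) (x : Ball N), (M g).indicator (1 : Ball N → ℝ≥0∞)
      ((h : Ball N ≃ₜ Ball N) x) = (M (g * h)).indicator 1 x := by
    intro g h x
    by_cases hx : x ∈ M (g * h)
    · rw [Set.indicator_of_mem hx, Set.indicator_of_mem ((hMmul g h x).2 hx)]
      rfl
    · rw [Set.indicator_of_notMem hx, Set.indicator_of_notMem (mt (hMmul g h x).1 hx)]
  let n : Ball N → ℝ≥0∞ := fun x => ∑' g : G, (M g).indicator 1 x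
  have hn : Measurable n := Measurable.tsum fun g => measurable_one.indicator (hM g)
  have hnmul : ∀ (h : G) (x : Ball N), n ((h : Ball N ≃ₜ Ball N) x) = n x := by
    intro h x
    simp only [n, hind]
    exact (Equiv.mulRight h).tsum_eq fun g => (M g).indicator (1 : Ball N → ℝ≥0∞) x
  let F : Ball N → ℝ≥0∞ := fun x => (M 1).indicator 1 x * (n x)⁻¹
  have hF : Measurable F := (measurable_one.indicator (hM 1)).mul hn.inv
  have hFsum : ∀ x, ∑' g : G, F ((g : Ball N ≃ₜ Ball N) x) ≤ 1 := by
    intro x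
    have h1 : ∀ g : G, F ((g : Ball N ≃ₜ Ball N) x) = (M g).indicator 1 x * (n x)⁻¹ := fun g => by
      simp only [F, hnmul, hind, one_mul]
    simp only [h1]
    rw [ENNReal.tsum_mul_right]
    exact ENNReal.mul_inv_le_one _
  have hint : ∫⁻ x, F x * poincareSeries G x s ∂μ ≤ μ Set.univ := by
    have hPm : ∀ g : G, Measurable fun x =>
        ENNReal.ofReal (conformalDeriv (g : Ball N ≃ₜ Ball N) x ^ s) * F x := fun g =>
      (measurable_ofReal_conformalDeriv_rpow (hG g g.2)).mul hF
    calc ∫⁻ x, F x * poincareSeries G x s ∂μ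
        = ∫⁻ x, ∑' g : G, ENNReal.ofReal (conformalDeriv (g : Ball N ≃ₜ Ball N) x ^ s) * F x ∂μ := by
          refine lintegral_congr fun x => ?_
          rw [ENNReal.tsum_mul_right, mul_comm]
          rfl
      _ = ∑' g : G, ∫⁻ x, F ((g : Ball N ≃ₜ Ball N).symm x) ∂μ := by
          rw [lintegral_tsum fun g => (hPm g).aemeasurable]
          exact tsum_congr fun g => (hμ.lintegral_comp hG g.2 hF).symm
      _ = ∫⁻ x, ∑' g : G, F ((g : Ball N ≃ₜ Ball N).symm x) ∂μ :=
          (lintegral_tsum fun g : G =>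
            (hF.comp (g : Ball N ≃ₜ Ball N).symm.continuous.measurable).aemeasurable).symm
      _ ≤ ∫⁻ _, 1 ∂μ := by
          refine lintegral_mono fun x => ?_
          refine le_trans (le_of_eq ?_) (hFsum x)
          exact (Equiv.inv G).tsum_eq fun g : G => F ((g : Ball N ≃ₜ Ball N) x)
      _ = μ Set.univ := lintegral_one
  have hPmeas : Measurable fun x => poincareSeries G x s :=
    Measurable.tsum fun g => measurable_ofReal_conformalDeriv_rpow (hG g g.2)
  have hae := ae_lt_top (hF.mul hPmeas) (hint.trans_lt (measure_lt_top μ _)).ne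
  -- Null sets are preserved by `G`, so that almost all points have a good orbit.
  have hall : ∀ᵐ x ∂μ, ∀ g : G, F ((g : Ball N ≃ₜ Ball N) x) *
      poincareSeries G ((g : Ball N ≃ₜ Ball N) x) s < ∞ := by
    refine ae_all_iff.2 fun g => ?_
    have hac : μ.map (g : Ball N ≃ₜ Ball N) ≪ μ := by
      have := hμ _ (G.inv_mem g.2)
      change μ.map (g : Ball N ≃ₜ Ball N) = _ at this
      rw [this]
      exact withDensity_absolutelyContinuous _ _
    exact ae_of_ae_map (g : Ball N ≃ₜ Ball N).continuous.measurable.aemeasurable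
      (hac.ae_le hae)
  filter_upwards [hall] with ζ hζ hfin
  obtain ⟨⟨g, hg⟩, hsup⟩ := exists_forall_le_of_finite_superlevel
    (fun g : G => conformalDeriv (g : Ball N ≃ₜ Ball N) ζ) (fun g => hjpos g ζ) hfin
  have hn_top : n ζ ≠ ∞ := by
    have hfinM : {k : G | ζ ∈ M k}.Finite := (hsup g).subset fun k hk => hk g
    have : n ζ = ∑ k ∈ hfinM.toFinset, (M k).indicator (1 : Ball N → ℝ≥0∞) ζ :=
      tsum_eq_sum fun k hk => Set.indicator_of_notMem (by simpa using hk) _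
    rw [this]
    refine ENNReal.sum_ne_top.2 fun k _ => ?_
    exact ((Set.indicator_le_self' (fun _ _ => zero_le) ζ).trans_lt ENNReal.one_lt_top).ne
  have hFne : F ((g : Ball N ≃ₜ Ball N) ζ) ≠ 0 := by
    have : (g : Ball N ≃ₜ Ball N) ζ ∈ M 1 := by rw [hMmul, one_mul]; exact hg
    simp only [F, hnmul, Set.indicator_of_mem this, Pi.one_apply, one_mul]
    exact ENNReal.inv_ne_zero.2 hn_top
  have hPg : poincareSeries G ((g : Ball N ≃ₜ Ball N) ζ) s < ∞ := by
    by_contra htop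
    have := hζ g
    rw [not_lt, top_le_iff] at htop
    rw [htop, ENNReal.mul_top hFne] at this
    exact lt_irrefl _ this
  rw [poincareSeries_eq_mul hG g.2]
  exact ENNReal.mul_lt_top ENNReal.ofReal_lt_top hPg

end IsConformalMeasure

end Measure

/-! ### Ending measures with atoms -/

section Atoms

variable {G : Subgroup (Ball N ≃ₜ Ball N)} {s : ℝ}

theorem poincareSeries_ne_zero (G : Subgroup (Ball N ≃ₜ Ball N)) (s : ℝ) (z : Ball N) :
    poincareSeries G z s ≠ 0 := by
  intro h
  have := ENNReal.tsum_eq_zero.1 h 1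
  rw [Subgroup.coe_one, conformalDeriv_one, Real.one_rpow] at this
  simp at this

theorem exists_probabilityMeasure_eq_orbitMeasure {z : Ball N} (hP : poincareSeries G z s < ∞) :
    ∃ μ : ProbabilityMeasure (Ball N), (μ : Measure (Ball N)) = orbitMeasure G s z := by
  refine ⟨⟨orbitMeasure G s z, ⟨?_⟩⟩, rfl⟩
  have h := lintegral_orbitMeasure G s z (f := fun _ => 1) measurable_const
  simp only [lintegral_one, mul_one] at h
  rw [h]
  exact ENNReal.inv_mul_cancel (poincareSeries_ne_zero G s z) hP.ne

/-- If the Poincaré series converges at `ζ` and its terms at `z n → ζ` are dominated by those at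
`ζ`, then the orbit measures converge weakly. -/
theorem tendsto_lintegral_orbitMeasure [Countable G] (hG : ∀ g ∈ G, IsConformal g) (hs : 0 < s)
    {ζ : Ball N} (hP : poincareSeries G ζ s < ∞) {z : ℕ → Ball N} (hz : Tendsto z atTop (𝓝 ζ))
    {K : ℝ} (hK : 0 ≤ K)
    (hle : ∀ n, ∀ g ∈ G, conformalDeriv g (z n) ≤ K * conformalDeriv g ζ)
    (f : BoundedContinuousFunction (Ball N) NNReal) :
    Tendsto (fun n => ∫⁻ x, f x ∂(orbitMeasure G s (z n))) atTop
      (𝓝 (∫⁻ x, f x ∂(orbitMeasure G s ζ))) := by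
  have hmeas : ∀ f : BoundedContinuousFunction (Ball N) NNReal,
      Measurable fun x => (f x : ℝ≥0∞) := fun f => f.continuous.measurable.coe_nnreal_ennreal
  let : MeasurableSpace G := ⊤
  have key : ∀ f : BoundedContinuousFunction (Ball N) NNReal,
      Tendsto (fun n => ∑' g : G,
        ENNReal.ofReal (conformalDeriv (g : Ball N ≃ₜ Ball N) (z n) ^ s) *
          (f ((g : Ball N ≃ₜ Ball N) (z n)) : ℝ≥0∞)) atTop
        (𝓝 (∑' g : G, ENNReal.ofReal (conformalDeriv (g : Ball N ≃ₜ Ball N) ζ ^ s) *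
          (f ((g : Ball N ≃ₜ Ball N) ζ) : ℝ≥0∞))) := by
    intro f
    simp only [← lintegral_count]
    refine tendsto_lintegral_of_dominated_convergence
      (fun g : G => ENNReal.ofReal (K ^ s) *
        ENNReal.ofReal (conformalDeriv (g : Ball N ≃ₜ Ball N) ζ ^ s) * (nndist f 0 : NNReal))
      (fun n => measurable_from_top) (fun n => Eventually.of_forall fun g => ?_) ?_
      (Eventually.of_forall fun g => ?_)
    · have hj := (hG g g.2).conformalDeriv_pos (z n)
      change _ * _ ≤ ENNReal.ofReal (K ^ s) *
        ENNReal.ofReal (conformalDeriv (g : Ball N ≃ₜ Ball N) ζ ^ s) * _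
      rw [← ENNReal.ofReal_mul (Real.rpow_nonneg hK s),
        ← Real.mul_rpow hK ((hG g g.2).conformalDeriv_pos ζ).le]
      gcongr
      · exact hle n g g.2
      · exact BoundedContinuousFunction.NNReal.upper_bound f _
    · rw [lintegral_count, ENNReal.tsum_mul_right, ENNReal.tsum_mul_left]
      exact ENNReal.mul_ne_top (ENNReal.mul_ne_top ENNReal.ofReal_ne_top hP.ne)
        ENNReal.coe_ne_top
    · refine ENNReal.Tendsto.mul ?_ (Or.inr ENNReal.coe_ne_top) ?_ (Or.inr ENNReal.ofReal_ne_top)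
      · exact ENNReal.tendsto_ofReal
          (((continuous_conformalDeriv_rpow (hG g g.2)).tendsto ζ).comp hz)
      · refine ENNReal.tendsto_coe.2 ?_
        exact ((f.continuous.comp (g : Ball N ≃ₜ Ball N).continuous).tendsto ζ).comp hz
  have hP1 : Tendsto (fun n => poincareSeries G (z n) s) atTop (𝓝 (poincareSeries G ζ s)) := by
    simpa [poincareSeries] using key 1
  simp only [lintegral_orbitMeasure G s _ (hmeas f)]
  refine ENNReal.Tendsto.mul (tendsto_inv_iff.2 hP1)
    (Or.inl (ENNReal.inv_ne_zero.2 hP.ne)) (key f)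
    (Or.inr (ENNReal.inv_ne_top.2 (poincareSeries_ne_zero G s ζ)))

/-- If the Poincaré series converges at a boundary point `ζ` for which `z₀` maximizes the Poisson
kernel over its orbit, then the orbit measure of `ζ` is an ending measure. -/
theorem exists_isEndingMeasure_eq_orbitMeasure [Countable G] (hG : ∀ g ∈ G, IsConformal g) (hs : 0 < s)
    (hconv : ∀ z ∈ openBall N, poincareSeries G z s < ∞) {z₀ ζ : Ball N}
    (hz₀ : IsDirichletCentre G z₀) (hζ : ζ ∈ sphere N)
    (hmax : ∀ g ∈ G, ballPoissonKernel (g z₀) ζ ≤ ballPoissonKernel z₀ ζ)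
    (hP : poincareSeries G ζ s < ∞) :
    ∃ μ : ProbabilityMeasure (Ball N), (μ : Measure (Ball N)) = orbitMeasure G s ζ ∧
      IsEndingMeasure G s μ := by
  obtain ⟨ρ, hρ, hcosh, C, hC⟩ := exists_geodesicRay hz₀.1 hζ
  have hmem : ∀ t, 0 ≤ t → ρ t ∈ dirichletDomain G z₀ := fun t ht =>
    mem_dirichletDomain_of_cosh hG hz₀ hζ hmax ht (hρ.mem_openBall t ht) (hcosh t ht)
  have hlim : Tendsto (fun n : ℕ => ρ n) atTop (𝓝 ζ) :=
    hρ.tendsto.comp tendsto_natCast_atTop_atTop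
  obtain ⟨μ, hμ⟩ := exists_probabilityMeasure_eq_orbitMeasure hP
  choose ν hν using fun n : ℕ => exists_probabilityMeasure_eq_orbitMeasure (G := G)
    (hconv _ (hρ.mem_openBall n n.cast_nonneg))
  refine ⟨μ, hμ, hconv, z₀, ζ, fun n => ρ n, hz₀,
    ⟨fun n => hmem n n.cast_nonneg, ⟨ρ, hρ, hmem, 0, fun n => ⟨n, n.cast_nonneg, ?_⟩⟩, hlim⟩,
    id, strictMono_id, ν, hν, ?_⟩
  · rw [hρ.isometry n n n.cast_nonneg n.cast_nonneg, sub_self, abs_zero]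
  · rw [ProbabilityMeasure.tendsto_iff_forall_lintegral_tendsto]
    simp only [hν, hμ]
    exact tendsto_lintegral_orbitMeasure hG hs hP hlim (K := 2 + 8 * |C|) (by positivity)
      fun n g hg => conformalDeriv_le_of_nontangential (hG g hg) hζ (hC n n.cast_nonneg)

theorem orbitMeasure_singleton_ne_zero [Countable G] {ζ : Ball N}
    (hP : poincareSeries G ζ s < ∞) : orbitMeasure G s ζ {ζ} ≠ 0 := by
  intro h
  rw [orbitMeasure, Measure.smul_apply, smul_eq_mul, mul_eq_zero, Measure.sum_apply_eq_zero] at h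
  have h1 := h.resolve_left (ENNReal.inv_ne_zero.2 hP.ne) 1
  rw [Subgroup.coe_one, conformalDeriv_one, Real.one_rpow] at h1
  have h2 : (1 : Ball N ≃ₜ Ball N) ζ = ζ := rfl
  simp [h2] at h1

theorem orbitMeasure_compl_limitSet [Countable G] {ζ : Ball N} (hζ : ζ ∈ limitSet G) :
    orbitMeasure G s ζ (limitSet G)ᶜ = 0 := by
  rw [orbitMeasure, Measure.smul_apply, smul_eq_mul, Measure.sum_apply_eq_zero.2, mul_zero]
  intro g
  rw [Measure.smul_apply, Measure.dirac_apply, Set.indicator_of_notMem, smul_zero]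
  exact fun h => h (map_mem_limitSet g.2 hζ)

/-- If the Poincaré series converges at a boundary point `ζ`, then the Poisson kernel at `ζ`
attains its maximum over each orbit. -/
theorem exists_forall_ballPoissonKernel_le (hG : ∀ g ∈ G, IsConformal g) (hs : 0 < s)
    {z₀ ζ : Ball N} (hz₀ : z₀ ∈ openBall N) (hζ : ζ ∈ sphere N)
    (hP : poincareSeries G ζ s < ∞) :
    ∃ h ∈ G, ∀ g ∈ G, ballPoissonKernel (g z₀) ζ ≤ ballPoissonKernel (h z₀) ζ := by
  set K := (1 - ‖(z₀ : EuclideanSpace ℝ (Fin (N + 1)))‖ ^ 2) /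
      (1 - ‖(z₀ : EuclideanSpace ℝ (Fin (N + 1)))‖) ^ 2 with hK
  have hKpos : 0 < K := (ballPoissonKernel_pos hz₀ hζ).trans_le (ballPoissonKernel_le hz₀ hζ)
  have hle : ∀ g : G, ballPoissonKernel ((g : Ball N ≃ₜ Ball N) z₀) ζ ≤
      K * conformalDeriv ((g⁻¹ : G) : Ball N ≃ₜ Ball N) ζ := by
    intro g
    have hg := hG _ (g⁻¹).2
    have h1 := hg.ballPoissonKernel_map (((hG g g.2).map_openBall z₀).2 hz₀) ζ
    have h2 : ((g⁻¹ : G) : Ball N ≃ₜ Ball N) ((g : Ball N ≃ₜ Ball N) z₀) = z₀ :=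
      (g : Ball N ≃ₜ Ball N).symm_apply_apply z₀
    rw [h2] at h1
    rw [← div_le_iff₀ (hg.conformalDeriv_pos ζ), ← h1]
    exact ballPoissonKernel_le hz₀ ((hg.map_sphere ζ).2 hζ)
  obtain ⟨⟨h, hh⟩, -⟩ := exists_forall_le_of_finite_superlevel
    (fun g : G => ballPoissonKernel ((g : Ball N ≃ₜ Ball N) z₀) ζ)
    (fun g => ballPoissonKernel_pos (((hG g g.2).map_openBall z₀).2 hz₀) hζ) fun c hc => by
      refine ((finite_setOf_le_conformalDeriv hs hP (div_pos hc hKpos)).preimage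
        (f := fun g : G => g⁻¹) inv_injective.injOn).subset fun g hg => ?_
      change c / K ≤ _
      rw [div_le_iff₀' hKpos]
      exact (le_of_lt hg).trans (hle g)
  exact ⟨h, h.2, fun g hg => hh ⟨g, hg⟩⟩

theorem exponent_pos_of_isEndingMeasure (hG : ∀ g ∈ G, IsConformal g)
    {μ : ProbabilityMeasure (Ball N)} (hμ : IsEndingMeasure G s μ)
    (hL : (μ : Measure (Ball N)) (limitSet G)ᶜ = 0) : 0 < s := by
  by_contra hs
  have := finite_of_nonpos hG (not_lt.1 hs) (hμ.1 _ origin_mem_openBall)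
  rw [limitSet_eq_empty_of_finite, Set.compl_empty, measure_univ] at hL
  exact one_ne_zero hL

/-- If the Poincaré series converges at a limit point, then some point of its `G`-orbit is an atom
of an ending measure on the limit set, and it is not a parabolic fixed point. -/
theorem exists_isEndingMeasure_atom [Countable G] (hG : ∀ g ∈ G, IsConformal g) (hs : 0 < s)
    (hconv : ∀ z ∈ openBall N, poincareSeries G z s < ∞) {z₀ ζ : Ball N}
    (hz₀ : IsDirichletCentre G z₀) (hζ : ζ ∈ limitSet G) (hP : poincareSeries G ζ s < ∞) :
    ∃ (μ : ProbabilityMeasure (Ball N)) (ξ : Ball N), IsEndingMeasure G s μ ∧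
      (μ : Measure (Ball N)) (limitSet G)ᶜ = 0 ∧ (μ : Measure (Ball N)) {ξ} ≠ 0 ∧
      ¬ IsParabolicFixedPoint G ξ := by
  have hfin : ∀ r : ℝ, 0 < r →
      {g : G | r ≤ conformalDeriv (g : Ball N ≃ₜ Ball N) (origin N)}.Finite := fun r hr =>
    finite_setOf_le_conformalDeriv hs (hconv _ origin_mem_openBall) hr
  have hζs := mem_sphere_of_accPt hfin (accPt_of_mem_limitSet hζ)
  obtain ⟨h, hh, hmax⟩ := exists_forall_ballPoissonKernel_le hG hs hz₀.1 hζs hP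
  have hh' := G.inv_mem hh
  have hc := hG _ hh'
  set ξ := (h⁻¹ : Ball N ≃ₜ Ball N) ζ with hξ
  have hξs : ξ ∈ sphere N := (hc.map_sphere ζ).2 hζs
  have hPξ : poincareSeries G ξ s < ∞ := by
    rw [poincareSeries_eq_mul hG hh'] at hP
    exact ENNReal.lt_top_of_mul_ne_top_right hP.ne
      (ENNReal.ofReal_pos.2 (Real.rpow_pos_of_pos (hc.conformalDeriv_pos ζ) s)).ne'
  have hmaxξ : ∀ g ∈ G, ballPoissonKernel (g z₀) ξ ≤ ballPoissonKernel z₀ ξ := by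
    intro g hg
    have hsymm : ∀ x, (h⁻¹ : Ball N ≃ₜ Ball N) (h x) = x := h.symm_apply_apply
    have h1 := hc.ballPoissonKernel_map
      (((hG _ (G.mul_mem hh hg)).map_openBall z₀).2 hz₀.1) ζ
    have h2 := hc.ballPoissonKernel_map (((hG h hh).map_openBall z₀).2 hz₀.1) ζ
    rw [hsymm] at h2
    have h3 := hmax _ (G.mul_mem hh hg)
    have h4 : (h * g) z₀ = h (g z₀) := rfl
    rw [h4, hsymm] at h1
    rw [h4] at h3
    rw [h1, h2]
    exact div_le_div_of_nonneg_right h3 (hc.conformalDeriv_pos ζ).le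
  obtain ⟨μ, hμeq, hμ⟩ :=
    exists_isEndingMeasure_eq_orbitMeasure hG hs hconv hz₀ hξs hmaxξ hPξ
  have hatom : (μ : Measure (Ball N)) {ξ} ≠ 0 := hμeq ▸ orbitMeasure_singleton_ne_zero hPξ
  refine ⟨μ, ξ, hμ, hμeq ▸ orbitMeasure_compl_limitSet (map_mem_limitSet hh' hζ), hatom,
    fun hpar => ?_⟩
  have hj : ∀ g ∈ G, g ξ = ξ → conformalDeriv g ξ = 1 := fun g hg hgξ =>
    (hμ.isConformalMeasure hG).conformalDeriv_eq_one_of_fixes hG hs.ne' hatom hg hgξ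
  refine (isParabolicFixedPoint_iff_infinite hξs G hG hj hfin).1 hpar
    ((finite_setOf_le_conformalDeriv hs hPξ one_pos).subset fun g hg => ?_)
  exact (hj g g.2 hg).ge

end Atoms

end Kleinian

theorem mainTheorem3 (N : ℕ) (hN : 1 ≤ N)
    (G : Subgroup (Kleinian.Ball N ≃ₜ Kleinian.Ball N)) (hG : Kleinian.IsKleinian G)
    (s : ℝ) (hs : Kleinian.criticalExponent G ≤ (s : EReal)) :
    (∀ μ : ProbabilityMeasure (Kleinian.Ball N), Kleinian.IsEndingMeasure G s μ →
        (μ : Measure (Kleinian.Ball N)) (Kleinian.limitSet G)ᶜ = 0 →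
        (μ : Measure (Kleinian.Ball N)) (Kleinian.bigHorosphericalLimitSet G)ᶜ = 0) ↔
    (∀ μ : ProbabilityMeasure (Kleinian.Ball N), Kleinian.IsEndingMeasure G s μ →
        (μ : Measure (Kleinian.Ball N)) (Kleinian.limitSet G)ᶜ = 0 →
        ∀ ζ : Kleinian.Ball N, (μ : Measure (Kleinian.Ball N)) {ζ} ≠ 0 →
          Kleinian.IsParabolicFixedPoint G ζ) := by
  have hc := hG.conformal
  constructor
  · intro h μ hμ hL ζ hζ
    have hspos := Kleinian.exponent_pos_of_isEndingMeasure hc hμ hL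
    have hfin : ∀ r : ℝ, 0 < r → {g : G | r ≤ Kleinian.conformalDeriv
        (g : Kleinian.Ball N ≃ₜ Kleinian.Ball N) (Kleinian.origin N)}.Finite := fun r hr =>
      Kleinian.finite_setOf_le_conformalDeriv hspos (hμ.1 _ Kleinian.origin_mem_openBall) hr
    have hH : ζ ∈ Kleinian.bigHorosphericalLimitSet G := by
      by_contra hH
      exact hζ (measure_mono_null (Set.singleton_subset_iff.2 hH) (h μ hμ hL))
    have hζs := Kleinian.mem_sphere_of_accPt hfin (Kleinian.accPt_of_mem_limitSet hH.1)
    have hconf := hμ.isConformalMeasure hc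
    obtain ⟨c, hcpos, hinf⟩ := Kleinian.infinite_setOf_lt_conformalDeriv_of_mem hζs hH
    refine (Kleinian.isParabolicFixedPoint_iff_infinite hζs G hc (fun g hg hgζ =>
      hconf.conformalDeriv_eq_one_of_fixes hc hspos.ne' hζ hg hgζ) hfin).2 ?_
    exact hconf.infinite_stabilizer hspos hζ hcpos hinf
  · intro h μ hμ hL
    have hspos := Kleinian.exponent_pos_of_isEndingMeasure hc hμ hL
    have hfin : ∀ r : ℝ, 0 < r → {g : G | r ≤ Kleinian.conformalDeriv
        (g : Kleinian.Ball N ≃ₜ Kleinian.Ball N) (Kleinian.origin N)}.Finite := fun r hr =>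
      Kleinian.finite_setOf_le_conformalDeriv hspos (hμ.1 _ Kleinian.origin_mem_openBall) hr
    have := Kleinian.countable_of_poincareSeries_lt_top hc (hμ.1 _ Kleinian.origin_mem_openBall)
    have hae := (hμ.isConformalMeasure hc).ae_poincareSeries_lt_top hc
    change ∀ᵐ ζ ∂(μ : Measure (Kleinian.Ball N)), ζ ∈ Kleinian.bigHorosphericalLimitSet G
    have hL' : ∀ᵐ ζ ∂(μ : Measure (Kleinian.Ball N)), ζ ∈ Kleinian.limitSet G := hL
    filter_upwards [hae, hL'] with ζ hζ hζL
    -- An exceptional point would give rise to an ending measure with a non-parabolic atom.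
    by_contra hH
    have hP := hζ fun c hcpos =>
      Kleinian.finite_setOf_lt_conformalDeriv_of_notMem hfin hc hζL hH hcpos
    obtain ⟨hconv, z₀, -, -, hz₀, -⟩ := hμ
    obtain ⟨ν, ξ, hν, hνL, hξ, hpar⟩ :=
      Kleinian.exists_isEndingMeasure_atom hc hspos hconv hz₀ hζL hP
    exact hpar (h ν hν hνL ξ hξ)
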